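/- Let $p\in\mathbb N$, let $H$ be a real $p\times p$ matrix all of whose (complex) eigenvalues have real part in $(0,1)\setminus\{1/2\}$, let $A$ be a complex $p\times p$ matrix, and put $D=H-\tfrac12 I$. For a real $p\times p$ matrix $M$ write $x_+^{M}=\exp((\log x)M)$ for $x>0$, $x_+^{M}=0$ for $x\le 0$, and $x_-^{M}=(-x)_+^{M}$. For $t\in\mathbb R$ let $$\widetilde g_t(x)=\frac{e^{\mathbf i tx}-1}{\mathbf i x}\bigl\{x_+^{-D}A+x_-^{-D}\overline A\bigr\},\qquad g_t=\mathcal F^{-1}(\widetilde g_t),$$ where $\mathcal F^{-1}$ is the entrywise unitary inverse Fourier transform on $L^2(\mathbb R)$, i.e. $\mathcal F^{-1}f(s)=(2\pi)^{-1/2}\int_{\mathbb R}e^{-\mathbf i sx}f(x)\,dx$; $g_t$ takes values in the real $p\times p$ matrices. For $\mathbb K\in\{\mathbb R,\mathbb C\}$ and a Lévy measure $\mu$ on $\mathbb K^p$ with $\mu(\{\mathbf 0\})=0$ and $\int\|\mathbf z\|^2\mu(d\mathbf z)<\infty$, let $N$ be a Poisson random measure on $\mathbb R\times\mathbb K^p$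 with intensity $dx\otimes\mu(d\mathbf z)$ and $\widetilde N=N-dx\otimes\mu(d\mathbf z)$; integrals with respect to $\widetilde N$ of square-integrable $\mathbb K^p$-valued functions are $L^2(\mathbb P)$-limits of integrals of finite linear combinations of indicators of measurable rectangles. A random vector is proper if its law is not concentrated on a proper subspace of $\mathbb R^p$. An orthogonal-increment random measure with control $dx\times I$ is an $L^2(\mathbb P)$-countably additive family of square-integrable $\mathbb K^p$-valued random vectors $\Phi(B)$, indexed by the Borel sets $B$ of finite Lebesgue measure $|B|$, such that $\mathbb E\,\Phi(B)\Phi(C)^*=0$ for disjoint $B,C$ and $\mathbb E\,\Phi(B)\Phi(B)^*=|B|\,I$; integrals of square-integrable matrix functions with respect to $\Phi$ are $L^2(\mathbb P)$-limits of integrals of step functions. (i) Let $X_H=\{X_H(t)\}_{t\in\mathbb R}$ be a moving average operator fractional Lévy motion (maofLm): an $\mathbb R^p$-valued process with $X_H(t)$ proper for every $t\neq0$ and $$\{X_H(t)\}_{t\in\mathbb R}\overset{\text{f.d.d.}}{=}\Bigl\{\int_{\mathbb R\times\mathbb R^p}g_t(s)\mathbf z\,\widetilde N(ds,d\mathbf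 z)\Bigr\}_{t\in\mathbb R},$$ where $\mu$ is a measure on $\mathbb R^p$ as above. If $\int_{\mathbb R^p}\mathbf z\mathbf z^*\mu(d\mathbf z)=I$, then there is a $\mathbb C^p$-valued, zero mean orthogonal-increment random measure $\Phi_{\mathcal M}$ with $\mathbb E\,\Phi_{\mathcal M}(dx)\Phi_{\mathcal M}(dx)^*=dx\times I$, defined on the probability space of $N$, such that $$\{X_H(t)\}_{t\in\mathbb R}\overset{\text{f.d.d.}}{=}\Bigl\{\int_{\mathbb R}\widetilde g_t(x)\,\Phi_{\mathcal M}(dx)\Bigr\}_{t\in\mathbb R}.$$ (ii) Let $\widetilde X_H=\{\widetilde X_H(t)\}_{t\in\mathbb R}$ be a real harmonizable operator fractional Lévy motion (rhofLm): an $\mathbb R^p$-valued process with $\widetilde X_H(t)$ proper for every $t\neq0$ and $$\widetilde X_H(t)=\int_{\mathbb R\times\mathbb C^p}\bigl\{\widetilde g_t(x)\mathbf z+\widetilde g_t(-x)\overline{\mathbf z}\bigr\}\widetilde N(dx,d\mathbf z),\qquad t\in\mathbb R,$$ where $\mu$ is a measure on $\mathbb C^p$ as above. If $4\int_{\mathbb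 C^p}(\Re\mathbf z)(\Re\mathbf z)^*\mu(d\mathbf z)=I=4\int_{\mathbb C^p}(\Im\mathbf z)(\Im\mathbf z)^*\mu(d\mathbf z)$ and $\mu(d\mathbf z)=\mu(e^{\mathbf i\theta}d\mathbf z)$ for all $\theta\in[-\pi,\pi)$, then there is an $\mathbb R^p$-valued, zero mean orthogonal-increment random measure $\Phi_{\widetilde{\mathcal M}}$ with $\mathbb E\,\Phi_{\widetilde{\mathcal M}}(ds)\Phi_{\widetilde{\mathcal M}}(ds)^*=ds\times I$, defined on the probability space of $N$, such that $$\{\widetilde X_H(t)\}_{t\in\mathbb R}\overset{\text{f.d.d.}}{=}\Bigl\{\int_{\mathbb R}g_t(s)\,\Phi_{\widetilde{\mathcal M}}(ds)\Bigr\}_{t\in\mathbb R}.$$ -/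

import Mathlib

open MeasureTheory ProbabilityTheory Filter Topology
open scoped ENNReal FourierTransform Matrix

noncomputable section

namespace OfLm

/-! ### Linear algebra -/

/-- The action of a matrix on a vector of Euclidean space. -/
def matVec {𝕜 : Type*} [RCLike 𝕜] {p : ℕ} (M : Matrix (Fin p) (Fin p) 𝕜)
    (z : EuclideanSpace 𝕜 (Fin p)) : EuclideanSpace 𝕜 (Fin p) :=
  WithLp.toLp 2 (M *ᵥ z.ofLp)

/-- The inclusion `ℝᵖ ⊆ ℂᵖ`. -/
def toC {p : ℕ} (x : EuclideanSpace ℝ (Fin p)) : EuclideanSpace ℂ (Fin p) :=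
  WithLp.toLp 2 (fun i => (x i : ℂ))

/-- Entrywise complex conjugation on `ℂᵖ`. -/
def conjVec {p : ℕ} (z : EuclideanSpace ℂ (Fin p)) : EuclideanSpace ℂ (Fin p) :=
  WithLp.toLp 2 (fun i => (starRingEnd ℂ) (z i))

/-- `x₊^M = exp((log x) M)` for `x > 0`, and `0` for `x ≤ 0`.  The power `x₋^M` is `posPow (-x) M`. -/
def posPow {p : ℕ} (x : ℝ) (M : Matrix (Fin p) (Fin p) ℝ) : Matrix (Fin p) (Fin p) ℝ :=
  if 0 < x then NormedSpace.exp (Real.log x • M) else 0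

/-- The set of real parts of the (complex) eigenvalues of the real matrix `H`. -/
def reEig {p : ℕ} (H : Matrix (Fin p) (Fin p) ℝ) : Set ℝ :=
  Complex.re '' spectrum ℂ (H.map Complex.ofReal)

/-- The matrix `E[U V*]`, for random vectors `U` and `V`. -/
def crossMoment {𝕜 : Type*} [RCLike 𝕜] {p : ℕ} {Ω : Type*} [MeasurableSpace Ω] (P : Measure Ω)
    (U V : Ω → EuclideanSpace 𝕜 (Fin p)) : Matrix (Fin p) (Fin p) 𝕜 :=
  Matrix.of fun i j => ∫ ω, U ω i * (starRingEnd 𝕜) (V ω j) ∂P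

/-! ### Integration kernels -/

/-- The harmonizable kernel
`g̃_t(x) = ((e^{itx} - 1) / (ix)) (x₊^{-D} A + x₋^{-D} Ā)`, where `D = H - (1/2) I`. -/
def harmKernel {p : ℕ} (H : Matrix (Fin p) (Fin p) ℝ) (A : Matrix (Fin p) (Fin p) ℂ)
    (t x : ℝ) : Matrix (Fin p) (Fin p) ℂ :=
  ((Complex.exp (Complex.I * t * x) - 1) / (Complex.I * x)) •
    ((posPow x (-(H - (1 / 2 : ℝ) • 1))).map Complex.ofReal * A +
      (posPow (-x) (-(H - (1 / 2 : ℝ) • 1))).map Complex.ofReal * A.map (starRingEnd ℂ))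

open Classical in
/-- The unitary inverse Fourier transform `s ↦ (2π)^{-1/2} ∫ e^{-isx} f(x) dx` on `L²(ℝ)`,
obtained by rescaling the `L²` transform `ξ ↦ ∫ e^{-2πiξx} f(x) dx`. -/
def invFourierL2 (f : ℝ → ℂ) : ℝ → ℂ :=
  if hf : MemLp f 2 (volume : Measure ℝ) then
    fun s => ((Real.sqrt (2 * Real.pi))⁻¹ : ℝ) *
      (𝓕 (hf.toLp f) : Lp ℂ 2 (volume : Measure ℝ)) (s / (2 * Real.pi))
  else 0

/-- The moving average kernel, the entrywise inverse Fourier transform of the harmonizable kernel.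
It is real because the latter satisfies `g̃_t(-x) = conj (g̃_t(x))`. -/
def maKernel {p : ℕ} (H : Matrix (Fin p) (Fin p) ℝ) (A : Matrix (Fin p) (Fin p) ℂ)
    (t s : ℝ) : Matrix (Fin p) (Fin p) ℝ :=
  Matrix.of fun i j => (invFourierL2 (fun x => harmKernel H A t x i j) s).re

/-! ### Poisson random measures and their compensated integrals -/

/-- `N` is a Poisson random measure with intensity measure `ν`. -/
structure IsPoissonRandomMeasure {S Ω : Type*} [MeasurableSpace S] [MeasurableSpace Ω]
    (N : Ω → Measure S) (ν : Measure S) (P : Measure Ω) : Prop where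
  measurable : ∀ B, MeasurableSet B → Measurable fun ω => N ω B
  law : ∀ B, MeasurableSet B → ν B ≠ ∞ →
    P.map (fun ω => N ω B) =
      (poissonMeasure (ν B).toNNReal).map (fun k : ℕ => (k : ℝ≥0∞))
  law_top : ∀ B, MeasurableSet B → ν B = ∞ → ∀ᵐ ω ∂P, N ω B = ∞
  indep : ∀ (n : ℕ) (B : Fin n → Set S), (∀ i, MeasurableSet (B i)) →
    Pairwise (Function.onFun Disjoint B) → iIndepFun (fun i ω => N ω (B i)) P

/-- A Lévy measure without mass at the origin and with finite second moment. -/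
structure IsLevyL2 {𝕜 : Type*} [RCLike 𝕜] {p : ℕ}
    (μ : Measure (EuclideanSpace 𝕜 (Fin p))) : Prop where
  zero : μ {0} = 0
  secondMoment : ∫⁻ z, ‖z‖ₑ ^ 2 ∂μ < ∞

/-- A formal finite sum `∑ i, coef i · 1_{set i}` over measurable sets of finite measure. -/
structure StepFn (S : Type*) [MeasurableSpace S] (ν : Measure S) (W : Type*) where
  n : ℕ
  coef : Fin n → W
  set : Fin n → Set S
  measurableSet : ∀ i, MeasurableSet (set i)
  finite : ∀ i, ν (set i) ≠ ∞

/-- The function represented by a step function. -/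
def StepFn.eval {S : Type*} [MeasurableSpace S] {ν : Measure S} {W : Type*} [AddCommMonoid W]
    (f : StepFn S ν W) (x : S) : W :=
  ∑ i, (f.set i).indicator (fun _ => f.coef i) x

/-- The integral `∑ i, coef i · Ñ(set i)` of a step function with respect to the compensated
Poisson random measure `Ñ = N - ν`. -/
def StepFn.poissonInt {S Ω : Type*} [MeasurableSpace S] {ν : Measure S} {𝕜 : Type*} [RCLike 𝕜]
    {p : ℕ} (f : StepFn S ν (EuclideanSpace 𝕜 (Fin p))) (N : Ω → Measure S) (ω : Ω) :
    EuclideanSpace 𝕜 (Fin p) :=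
  ∑ i, (((N ω (f.set i)).toReal - (ν (f.set i)).toReal : ℝ) : 𝕜) • f.coef i

/-- `Y` is (a version of) the stochastic integral `∫ φ(x, z) Ñ(dx, dz)` of `φ ∈ L²(dx ⊗ μ)`:
the `L²(P)`-limit of the integrals of elementary functions, i.e. step functions over rectangles,
which converge to `φ` in `L²(dx ⊗ μ)`. -/
def IsPoissonIntegral {𝕜 : Type*} [RCLike 𝕜] {p : ℕ} {Ω : Type*} [MeasurableSpace Ω]
    (N : Ω → Measure (ℝ × EuclideanSpace 𝕜 (Fin p))) (μ : Measure (EuclideanSpace 𝕜 (Fin p)))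
    (P : Measure Ω) (φ : ℝ × EuclideanSpace 𝕜 (Fin p) → EuclideanSpace 𝕜 (Fin p))
    (Y : Ω → EuclideanSpace 𝕜 (Fin p)) : Prop :=
  MemLp φ 2 ((volume : Measure ℝ).prod μ) ∧ MemLp Y 2 P ∧
  ∃ F : ℕ → StepFn (ℝ × EuclideanSpace 𝕜 (Fin p)) ((volume : Measure ℝ).prod μ)
      (EuclideanSpace 𝕜 (Fin p)),
    (∀ k i, ∃ (B₁ : Set ℝ) (B₂ : Set (EuclideanSpace 𝕜 (Fin p))),
      MeasurableSet B₁ ∧ MeasurableSet B₂ ∧ (F k).set i = B₁ ×ˢ B₂) ∧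
    Tendsto (fun k => eLpNorm (fun w => (F k).eval w - φ w) 2 ((volume : Measure ℝ).prod μ))
      atTop (𝓝 0) ∧
    Tendsto (fun k => eLpNorm (fun ω => (F k).poissonInt N ω - Y ω) 2 P) atTop (𝓝 0)

/-! ### Orthogonal-increment random measures and their integrals -/

/-- `Φ` is a zero mean orthogonal-increment random measure with values in `𝕜ᵖ`, defined on the
Borel sets of finite Lebesgue measure, such that `E[Φ(dx) Φ(dx)*] = dx × I`. -/
structure IsOrthogonalRandomMeasure {𝕜 : Type*} [RCLike 𝕜] {p : ℕ} {Ω : Type*}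
    [MeasurableSpace Ω] (Φ : Set ℝ → Ω → EuclideanSpace 𝕜 (Fin p)) (P : Measure Ω) : Prop where
  memLp : ∀ B, MeasurableSet B → volume B ≠ ∞ → MemLp (Φ B) 2 P
  /-- Countable additivity in `L²(P)`. -/
  additive : ∀ B : ℕ → Set ℝ, (∀ n, MeasurableSet (B n)) → Pairwise (Function.onFun Disjoint B) →
    volume (⋃ n, B n) ≠ ∞ →
    Tendsto (fun n => eLpNorm (fun ω => (∑ k ∈ Finset.range n, Φ (B k) ω) - Φ (⋃ n, B n) ω) 2 P)
      atTop (𝓝 0)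
  mean_zero : ∀ B, MeasurableSet B → volume B ≠ ∞ → ∫ ω, Φ B ω ∂P = 0
  orthogonal : ∀ B C, MeasurableSet B → MeasurableSet C → volume B ≠ ∞ → volume C ≠ ∞ →
    Disjoint B C → crossMoment P (Φ B) (Φ C) = 0
  control : ∀ B, MeasurableSet B → volume B ≠ ∞ →
    crossMoment P (Φ B) (Φ B) = (((volume B).toReal : ℝ) : 𝕜) • 1

/-- The integral `∑ i, coef i Φ(set i)` of a matrix-valued step function. -/
def StepFn.orthInt {Ω : Type*} {𝕜 : Type*} [RCLike 𝕜] {p : ℕ}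
    (f : StepFn ℝ volume (Matrix (Fin p) (Fin p) 𝕜)) (Φ : Set ℝ → Ω → EuclideanSpace 𝕜 (Fin p))
    (ω : Ω) : EuclideanSpace 𝕜 (Fin p) :=
  ∑ i, matVec (f.coef i) (Φ (f.set i) ω)

/-- `Y` is (a version of) the integral `∫ f(x) Φ(dx)` of `f ∈ L²(ℝ, M(p, 𝕜))`, the `L²(P)`-limit of
the integrals of step functions which converge to `f` in `L²`. -/
def IsOrthIntegral {𝕜 : Type*} [RCLike 𝕜] {p : ℕ} {Ω : Type*} [MeasurableSpace Ω]
    (Φ : Set ℝ → Ω → EuclideanSpace 𝕜 (Fin p)) (P : Measure Ω)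
    (f : ℝ → Matrix (Fin p) (Fin p) 𝕜) (Y : Ω → EuclideanSpace 𝕜 (Fin p)) : Prop :=
  (∀ i j, MemLp (fun x => f x i j) 2 (volume : Measure ℝ)) ∧ MemLp Y 2 P ∧
  ∃ F : ℕ → StepFn ℝ volume (Matrix (Fin p) (Fin p) 𝕜),
    (∀ i j, Tendsto (fun k => eLpNorm (fun x => (F k).eval x i j - f x i j) 2
      (volume : Measure ℝ)) atTop (𝓝 0)) ∧
    Tendsto (fun k => eLpNorm (fun ω => (F k).orthInt Φ ω - Y ω) 2 P) atTop (𝓝 0)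

/-! ### Processes -/

/-- Equality of the finite-dimensional distributions of two processes indexed by `ℝ`. -/
def FddEq {Ω Ω' E : Type*} [MeasurableSpace Ω] [MeasurableSpace Ω'] [MeasurableSpace E]
    (X : ℝ → Ω → E) (P : Measure Ω) (Y : ℝ → Ω' → E) (P' : Measure Ω') : Prop :=
  ∀ (n : ℕ) (t : Fin n → ℝ),
    IdentDistrib (fun ω i => X (t i) ω) (fun ω i => Y (t i) ω) P P'

/-- The law of `U` is proper: it is not concentrated on a proper subspace of `ℝᵖ`. -/
def IsProper {p : ℕ} {Ω : Type*} [MeasurableSpace Ω] (U : Ω → EuclideanSpace ℝ (Fin p))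
    (P : Measure Ω) : Prop :=
  ∀ W : Submodule ℝ (EuclideanSpace ℝ (Fin p)), W ≠ ⊤ → ¬ ∀ᵐ ω ∂P, U ω ∈ W

/-- The process `X` on `(Ω, P)` is a moving average operator fractional Lévy motion with Hurst
matrix `H` and parameter `A`, driven by the Poisson random measure `N` on `(Ω₀, P₀)` with intensity
`ds ⊗ μ`: it is proper and has the finite-dimensional distributions of `∫ g_t(s) z Ñ(ds, dz)`. -/
structure IsMaofLm {p : ℕ} {Ω Ω₀ : Type*} [MeasurableSpace Ω] [MeasurableSpace Ω₀]
    (H : Matrix (Fin p) (Fin p) ℝ) (A : Matrix (Fin p) (Fin p) ℂ)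
    (μ : Measure (EuclideanSpace ℝ (Fin p))) (N : Ω₀ → Measure (ℝ × EuclideanSpace ℝ (Fin p)))
    (P₀ : Measure Ω₀) (X : ℝ → Ω → EuclideanSpace ℝ (Fin p)) (P : Measure Ω) : Prop where
  hurst : reEig H ⊆ Set.Ioo 0 1
  levy : IsLevyL2 μ
  poisson : IsPoissonRandomMeasure N ((volume : Measure ℝ).prod μ) P₀
  proper : ∀ t, t ≠ 0 → IsProper (X t) P
  repr : ∃ Y : ℝ → Ω₀ → EuclideanSpace ℝ (Fin p),
    (∀ t, IsPoissonIntegral N μ P₀ (fun w => matVec (maKernel H A t w.1) w.2) (Y t)) ∧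
    FddEq X P Y P₀

/-- The process `X` on `(Ω, P)` is a real harmonizable operator fractional Lévy motion with Hurst
matrix `H` and parameter `A`, driven by the Poisson random measure `N` on `(Ω, P)` with intensity
`dx ⊗ μ`: it is proper and `X(t) = ∫ (g̃_t(x) z + g̃_t(-x) z̄) Ñ(dx, dz)`. -/
structure IsRhofLm {p : ℕ} {Ω : Type*} [MeasurableSpace Ω]
    (H : Matrix (Fin p) (Fin p) ℝ) (A : Matrix (Fin p) (Fin p) ℂ)
    (μ : Measure (EuclideanSpace ℂ (Fin p))) (N : Ω → Measure (ℝ × EuclideanSpace ℂ (Fin p)))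
    (X : ℝ → Ω → EuclideanSpace ℝ (Fin p)) (P : Measure Ω) : Prop where
  hurst : reEig H ⊆ Set.Ioo 0 1
  levy : IsLevyL2 μ
  poisson : IsPoissonRandomMeasure N ((volume : Measure ℝ).prod μ) P
  proper : ∀ t, t ≠ 0 → IsProper (X t) P
  repr : ∀ t, IsPoissonIntegral N μ P
    (fun w => matVec (harmKernel H A t w.1) w.2 + matVec (harmKernel H A t (-w.1)) (conjVec w.2))
    (fun ω => toC (X t ω))

/-- `∫ z z* μ(dz) = I`, for a measure `μ` on `ℝᵖ`. -/
def UnitSecondMoment {p : ℕ} (μ : Measure (EuclideanSpace ℝ (Fin p))) : Prop :=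
  (Matrix.of fun i j => ∫ z, z i * z j ∂μ : Matrix (Fin p) (Fin p) ℝ) = 1

/-- `4 ∫ (Re z) (Re z)* μ(dz) = I = 4 ∫ (Im z) (Im z)* μ(dz)`, for a measure `μ` on `ℂᵖ`. -/
def UnitSecondMomentC {p : ℕ} (μ : Measure (EuclideanSpace ℂ (Fin p))) : Prop :=
  (4 : ℝ) • (Matrix.of fun i j => ∫ z, (z i).re * (z j).re ∂μ : Matrix (Fin p) (Fin p) ℝ) = 1 ∧
  (4 : ℝ) • (Matrix.of fun i j => ∫ z, (z i).im * (z j).im ∂μ : Matrix (Fin p) (Fin p) ℝ) = 1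

/-- Invariance of `μ` under the rotations `z ↦ e^{iθ} z` of `ℂᵖ`. -/
def RotationInvariant {p : ℕ} (μ : Measure (EuclideanSpace ℂ (Fin p))) : Prop :=
  ∀ θ ∈ Set.Ico (-Real.pi) Real.pi, μ.map (fun z => Complex.exp (Complex.I * θ) • z) = μ

end OfLm

end

noncomputable section

/-! Integration against the compensated Poisson measure extends to an isometry `I` from L²(dx ⊗ μ)
to L²(P): indicators and compensated counts have the same Gram matrix ν(B ∩ C), and indicators are
total. Both claims amount to constructing operators K_j : L²(ℝ) → L²(P), one per coordinate, with
⟨K_i f, K_j g⟩ = δ_ij ⟨f, g⟩ and centred values. Then Φ(B)_j = K_j(1_B) is an orthogonal random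
measure with control dx × I, and ∫ f dΦ has i-th coordinate Σ_j K_j(f_ij)
(`isOrthogonalRandomMeasure_orthMeasure`, `isOrthIntegral_orthMeasure`).

(i) Let U be the unitary Fourier transform, so that g_t = U g̃_t entrywise. Take K_j f = I(U f ⊗
z_j). Orthonormality is the unit second moment of μ, and Σ_j K_j(g̃_ij) is the i-th coordinate of
the given moving average integral.

(ii) Let R be reflection and L_j f = I(f ⊗ z_j + R f ⊗ z̄_j). In ⟨L_i f, L_j g⟩ the mixed terms
carry ∫ z_i z_j dμ or its conjugate, which vanish by rotation invariance; the other two add up to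
δ_ij ⟨f, g⟩ by the moment normalisation. For real f, U⁻¹ f is Hermitian and L_j of a Hermitian
function is real, so K_j f = Re L_j(U⁻¹ f) is an isometry between real L² spaces, and K_j g_ij = Re
L_j(g̃_ij).

In both cases the new integral equals the Poisson integral almost surely, not only in law. The
remaining analytic input is g̃_t ∈ L² (`memLp_harmKernel`): a spectral bound on matrix exponentials
gives, for some b < 1/2, growth x^(-b) at 0 and x^(b-1) at infinity. -/

namespace OfLm

/-! ### Isometries from equal Gram matrices -/

section GramExtension

/-- Vectors with the same Gram matrix, the first family being total, are matched by a linear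
isometry. -/
lemma exists_clm_of_inner_eq {𝕜 ι V W : Type*} [RCLike 𝕜] [NormedAddCommGroup V]
    [InnerProductSpace 𝕜 V] [NormedAddCommGroup W] [InnerProductSpace 𝕜 W] [CompleteSpace W]
    (v : ι → V) (w : ι → W) (h : ∀ i j, inner 𝕜 (v i) (v j) = inner 𝕜 (w i) (w j))
    (hv : Dense (Submodule.span 𝕜 (Set.range v) : Set V)) :
    ∃ T : V →L[𝕜] W, (∀ i, T (v i) = w i) ∧ ∀ x y, inner 𝕜 (T x) (T y) = inner 𝕜 x y := by
  set e := Finsupp.linearCombination 𝕜 v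
  set f := Finsupp.linearCombination 𝕜 w
  have hd : DenseRange e := by
    have : Set.range e = (Submodule.span 𝕜 (Set.range v) : Set V) := by
      rw [← Finsupp.range_linearCombination]; rfl
    rw [DenseRange, this]; exact hv
  have hin : ∀ x y, inner 𝕜 (f x) (f y) = inner 𝕜 (e x) (e y) := by
    intro x y
    simp only [e, f, Finsupp.linearCombination_apply, Finsupp.sum_inner, Finsupp.inner_sum,
      inner_smul_left, inner_smul_right, h]
  have hn : ∀ x, ‖f x‖ ≤ 1 * ‖e x‖ := by
    intro x
    rw [one_mul, @norm_eq_sqrt_re_inner 𝕜, @norm_eq_sqrt_re_inner 𝕜 _ _ _ _ (e x), hin]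
  have hT : ∀ x, f.extendOfNorm e (e x) = f x := fun x =>
    LinearMap.extendOfNorm_eq hd ⟨1, hn⟩ x
  refine ⟨f.extendOfNorm e, fun i => ?_, fun x y => ?_⟩
  · have := hT (Finsupp.single i 1)
    simpa [e, f] using this
  · refine hd.induction_on₂ (p := fun x y => inner 𝕜 (f.extendOfNorm e x) (f.extendOfNorm e y) =
      inner 𝕜 x y) ?_ ?_ x y
    · exact isClosed_eq (by fun_prop) (by fun_prop)
    · intro a b
      rw [hT, hT, hin]

end GramExtension

/-! ### First two moments of the Poisson law -/

section PoissonMoments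

lemma hasSum_poisson_mul_cast (r : ℝ) :
    HasSum (fun n : ℕ => Real.exp (-r) * r ^ n / n.factorial * n) r := by
  have h1 : HasSum (fun n : ℕ => r * (Real.exp (-r) * r ^ n / n.factorial)) (r * 1) := by
    refine HasSum.mul_left r ?_
    have := (NormedSpace.expSeries_div_hasSum_exp r).mul_left (Real.exp (-r))
    rw [← Real.exp_eq_exp_ℝ, ← Real.exp_add, neg_add_cancel, Real.exp_zero] at this
    simpa only [mul_div_assoc] using this
  rw [← hasSum_nat_add_iff' 1]
  have e : ∀ n : ℕ, Real.exp (-r) * r ^ (n + 1) / (n + 1).factorial * ((n + 1 : ℕ) : ℝ) =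
      r * (Real.exp (-r) * r ^ n / n.factorial) := fun n => by
    rw [Nat.factorial_succ]
    have : (n.factorial : ℝ) ≠ 0 := by positivity
    push_cast
    field_simp
    ring
  simp only [e]
  simpa using h1

/-- With w_n the Poisson weights, w_{n+1}(n+1)² = r n w_n + (n+1) w_{n+1}, so the sum is r times the
mean plus the mean. -/
lemma hasSum_poisson_mul_cast_sq (r : ℝ) :
    HasSum (fun n : ℕ => Real.exp (-r) * r ^ n / n.factorial * (n : ℝ) ^ 2) (r ^ 2 + r) := by
  have h1 := (hasSum_poisson_mul_cast r).mul_left r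
  have h2 := hasSum_poisson_mul_cast r
  rw [← hasSum_nat_add_iff' 1] at h2 ⊢
  have e : ∀ n : ℕ, Real.exp (-r) * r ^ (n + 1) / (n + 1).factorial * ((n + 1 : ℕ) : ℝ) ^ 2 =
      r * (Real.exp (-r) * r ^ n / n.factorial * n) +
        Real.exp (-r) * r ^ (n + 1) / (n + 1).factorial * ((n + 1 : ℕ) : ℝ) := fun n => by
    rw [Nat.factorial_succ]
    have : (n.factorial : ℝ) ≠ 0 := by positivity
    push_cast
    field_simp
    ring
  simp only [e]
  simpa [sq] using h1.add h2

variable (r : NNReal)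

lemma memLp_cast_poissonMeasure : MemLp (fun n : ℕ => (n : ℝ)) 2 (poissonMeasure r) := by
  rw [memLp_two_iff_integrable_sq .of_discrete, integrable_poissonMeasure_iff]
  simpa using (hasSum_poisson_mul_cast_sq r).summable

lemma integral_cast_poissonMeasure : ∫ n : ℕ, (n : ℝ) ∂poissonMeasure r = r := by
  rw [integral_poissonMeasure]
  simpa using (hasSum_poisson_mul_cast r).tsum_eq

lemma integral_cast_sq_poissonMeasure :
    ∫ n : ℕ, (n : ℝ) ^ 2 ∂poissonMeasure r = (r : ℝ) ^ 2 + r := by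
  rw [integral_poissonMeasure]
  simpa using (hasSum_poisson_mul_cast_sq r).tsum_eq

end PoissonMoments

/-! ### Covariance of the compensated Poisson measure -/

section CompensatedPoisson

variable {S Ω : Type*} [MeasurableSpace S] [MeasurableSpace Ω]

/-- The compensated random measure `Ñ(B) = N(B) - ν(B)`. -/
def compensated (N : Ω → Measure S) (ν : Measure S) (B : Set S) (ω : Ω) : ℝ :=
  (N ω B).toReal - (ν B).toReal

variable {N : Ω → Measure S} {ν : Measure S} {P : Measure Ω}

lemma IsPoissonRandomMeasure.memLp_compensated [IsProbabilityMeasure P]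
    (h : IsPoissonRandomMeasure N ν P) {B : Set S}
    (hB : MeasurableSet B) (hf : ν B ≠ ∞) : MemLp (compensated N ν B) 2 P := by
  refine MemLp.sub (f := fun ω => (N ω B).toReal) ?_ (memLp_const _)
  have h1 : MemLp ENNReal.toReal 2 (P.map fun ω => N ω B) := by
    rw [h.law B hB hf, memLp_map_measure_iff
      ENNReal.measurable_toReal.aestronglyMeasurable .of_discrete]
    simpa [Function.comp_def] using memLp_cast_poissonMeasure _
  exact h1.comp_of_map (h.measurable B hB).aemeasurable

lemma IsPoissonRandomMeasure.integral_comp (h : IsPoissonRandomMeasure N ν P) {B : Set S}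
    (hB : MeasurableSet B) (hf : ν B ≠ ∞) (g : ℝ → ℝ) (hg : Measurable g) :
    ∫ ω, g (N ω B).toReal ∂P = ∫ n : ℕ, g n ∂poissonMeasure (ν B).toNNReal := by
  have hm : Measurable fun x : ℝ≥0∞ => g x.toReal := hg.comp ENNReal.measurable_toReal
  rw [← integral_map (φ := fun ω => N ω B) (f := fun x => g x.toReal)
    (h.measurable B hB).aemeasurable hm.aestronglyMeasurable, h.law B hB hf,
    integral_map .of_discrete hm.aestronglyMeasurable]
  simp

lemma IsPoissonRandomMeasure.integral_compensated [IsProbabilityMeasure P]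
    (h : IsPoissonRandomMeasure N ν P) {B : Set S}
    (hB : MeasurableSet B) (hf : ν B ≠ ∞) : ∫ ω, compensated N ν B ω ∂P = 0 := by
  have hi := (memLp_cast_poissonMeasure (ν B).toNNReal).integrable (by norm_num)
  have := h.integral_comp hB hf (fun x => x - (ν B).toReal) (by fun_prop)
  rw [integral_sub hi (integrable_const _), integral_cast_poissonMeasure] at this
  rw [show (∫ ω, compensated N ν B ω ∂P) = _ from this]
  simp [ENNReal.toReal]

lemma IsPoissonRandomMeasure.integral_compensated_sq [IsProbabilityMeasure P]
    (h : IsPoissonRandomMeasure N ν P)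
    {B : Set S} (hB : MeasurableSet B) (hf : ν B ≠ ∞) :
    ∫ ω, compensated N ν B ω * compensated N ν B ω ∂P = (ν B).toReal := by
  have h2 := memLp_cast_poissonMeasure (ν B).toNNReal
  have hi := h2.integrable (by norm_num)
  set r := (ν B).toReal with hr
  have hr' : (((ν B).toNNReal : NNReal) : ℝ) = r := rfl
  have := h.integral_comp hB hf (fun x => (x - r) * (x - r)) (by fun_prop)
  have he : (fun n : ℕ => ((n : ℝ) - r) * ((n : ℝ) - r)) =
      fun n : ℕ => ((n : ℝ) ^ 2 - 2 * r * n) + r ^ 2 := by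
    funext n; ring
  have hsq : Integrable (fun n : ℕ => (n : ℝ) ^ 2) (poissonMeasure (ν B).toNNReal) :=
    h2.integrable_sq
  have hd : Integrable (fun n : ℕ => (n : ℝ) ^ 2 - 2 * r * n) (poissonMeasure (ν B).toNNReal) :=
    hsq.sub (hi.const_mul _)
  have hm : Integrable (fun n : ℕ => 2 * r * (n : ℝ)) (poissonMeasure (ν B).toNNReal) :=
    hi.const_mul _
  rw [he, integral_add hd (integrable_const _), integral_sub hsq hm,
    integral_const_mul, integral_cast_poissonMeasure, integral_cast_sq_poissonMeasure, hr'] at this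
  rw [show (∫ ω, compensated N ν B ω * compensated N ν B ω ∂P) = _ from this]
  simp
  ring

lemma IsPoissonRandomMeasure.integral_compensated_mul_of_disjoint [IsProbabilityMeasure P]
    (h : IsPoissonRandomMeasure N ν P) {B C : Set S} (hB : MeasurableSet B)
    (hC : MeasurableSet C) (hfB : ν B ≠ ∞) (hd : Disjoint B C) :
    ∫ ω, compensated N ν B ω * compensated N ν C ω ∂P = 0 := by
  have hi := h.indep 2 ![B, C] (by intro i; fin_cases i <;> simpa) (by
    intro i j hij
    fin_cases i <;> fin_cases j <;> simp_all [Function.onFun, hd.symm])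
  have h01 : IndepFun (fun ω => N ω B) (fun ω => N ω C) P := by
    simpa using hi.indepFun (i := 0) (j := 1) (by norm_num)
  have hi2 : IndepFun (compensated N ν B) (compensated N ν C) P :=
    h01.comp (φ := fun x : ℝ≥0∞ => x.toReal - (ν B).toReal)
      (ψ := fun x : ℝ≥0∞ => x.toReal - (ν C).toReal) (by fun_prop) (by fun_prop)
  have hm : ∀ B, MeasurableSet B → AEStronglyMeasurable (compensated N ν B) P := fun B hB =>
    ((h.measurable B hB).ennreal_toReal.sub_const _).aestronglyMeasurable
  rw [hi2.integral_fun_mul_eq_mul_integral (hm B hB) (hm C hC), h.integral_compensated hB hfB,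
    zero_mul]

lemma IsPoissonRandomMeasure.ae_lt_top (h : IsPoissonRandomMeasure N ν P) {B : Set S}
    (hB : MeasurableSet B) (hf : ν B ≠ ∞) : ∀ᵐ ω ∂P, N ω B < ∞ := by
  have : ∀ᵐ x ∂(P.map fun ω => N ω B), x < ∞ := by
    rw [h.law B hB hf, ae_map_iff .of_discrete measurableSet_Iio]
    simp
  exact ae_of_ae_map (h.measurable B hB).aemeasurable this

/-- `N ω` is additive for every ω, but `toReal` sends ∞ to 0, so additivity of the real-valued
counts is only available where `N ω B` is finite, that is, almost surely. -/
lemma IsPoissonRandomMeasure.compensated_inter_add_diff (h : IsPoissonRandomMeasure N ν P)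
    {B C : Set S} (hB : MeasurableSet B) (hC : MeasurableSet C) (hf : ν B ≠ ∞) :
    compensated N ν B =ᵐ[P] fun ω => compensated N ν (B ∩ C) ω + compensated N ν (B \ C) ω := by
  filter_upwards [h.ae_lt_top hB hf] with ω hω
  have key : ∀ ρ : Measure S, ρ B ≠ ∞ →
      (ρ B).toReal = (ρ (B ∩ C)).toReal + (ρ (B \ C)).toReal := fun ρ hρ => by
    rw [← measure_inter_add_sdiff B hC, ENNReal.toReal_add
      (measure_ne_top_of_subset Set.inter_subset_left hρ)
      (measure_ne_top_of_subset Set.sdiff_subset hρ)]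
  simp only [compensated, key _ hω.ne, key _ hf]
  ring

/-- The covariance structure of the compensated Poisson random measure. -/
lemma IsPoissonRandomMeasure.integral_compensated_mul [IsProbabilityMeasure P]
    (h : IsPoissonRandomMeasure N ν P)
    {B C : Set S} (hB : MeasurableSet B) (hC : MeasurableSet C) (hfB : ν B ≠ ∞)
    (hfC : ν C ≠ ∞) :
    ∫ ω, compensated N ν B ω * compensated N ν C ω ∂P = (ν (B ∩ C)).toReal := by
  have hI : MeasurableSet (B ∩ C) := hB.inter hC
  have hfI : ν (B ∩ C) ≠ ∞ := measure_ne_top_of_subset Set.inter_subset_left hfB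
  have hfBC : ν (B \ C) ≠ ∞ := measure_ne_top_of_subset Set.sdiff_subset hfB
  have hfCB : ν (C \ B) ≠ ∞ := measure_ne_top_of_subset Set.sdiff_subset hfC
  have hl1 := h.memLp_compensated hI hfI
  have hl2 := h.memLp_compensated (hB.diff hC) hfBC
  have hl3 := h.memLp_compensated (hC.diff hB) hfCB
  have hp : ∀ {f g : Ω → ℝ}, MemLp f 2 P → MemLp g 2 P → Integrable (fun ω => f ω * g ω) P :=
    fun hf hg => hf.integrable_mul hg
  have i1 := hp hl1 hl1
  have i2 := hp hl1 hl3
  have i3 := hp hl2 hl1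
  have i4 := hp hl2 hl3
  have i12 : Integrable (fun ω => compensated N ν (B ∩ C) ω * compensated N ν (B ∩ C) ω +
      compensated N ν (B ∩ C) ω * compensated N ν (C \ B) ω) P := i1.add i2
  have i34 : Integrable (fun ω => compensated N ν (B \ C) ω * compensated N ν (B ∩ C) ω +
      compensated N ν (B \ C) ω * compensated N ν (C \ B) ω) P := i3.add i4
  -- Both sets are split along B ∩ C; the three products over disjoint pieces have mean zero by
  -- independence, leaving the variance on B ∩ C.
  have e : (fun ω => compensated N ν B ω * compensated N ν C ω) =ᵐ[P] fun ω =>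
      (compensated N ν (B ∩ C) ω * compensated N ν (B ∩ C) ω +
        compensated N ν (B ∩ C) ω * compensated N ν (C \ B) ω) +
      (compensated N ν (B \ C) ω * compensated N ν (B ∩ C) ω +
        compensated N ν (B \ C) ω * compensated N ν (C \ B) ω) := by
    have hCI := h.compensated_inter_add_diff hC hB hfC
    rw [Set.inter_comm] at hCI
    filter_upwards [h.compensated_inter_add_diff hB hC hfB, hCI] with ω h1 h2
    rw [h1, h2]; ring
  have d1 : Disjoint (B ∩ C) (C \ B) := Set.disjoint_left.2 fun x hx hx' => hx'.2 hx.1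
  have d2 : Disjoint (B \ C) (B ∩ C) := Set.disjoint_left.2 fun x hx hx' => hx.2 hx'.2
  have d3 : Disjoint (B \ C) (C \ B) := Set.disjoint_left.2 fun x hx hx' => hx.2 hx'.1
  rw [integral_congr_ae e, integral_add i12 i34, integral_add i1 i2,
    integral_add i3 i4, h.integral_compensated_sq hI hfI,
    h.integral_compensated_mul_of_disjoint hI (hC.diff hB) hfI d1,
    h.integral_compensated_mul_of_disjoint (hB.diff hC) hI hfBC d2,
    h.integral_compensated_mul_of_disjoint (hB.diff hC) (hC.diff hB) hfBC d3]
  simp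

end CompensatedPoisson

/-! ### Indicators and conjugation in L² -/

section LpLemmas

variable {α : Type*} [MeasurableSpace α] {μ : Measure α}

lemma toLp_finsetSum {E ι : Type*} [NormedAddCommGroup E] {q : ℝ≥0∞} (s : Finset ι)
    {f : ι → α → E} (hf : ∀ i, MemLp (f i) q μ) {g : α → E} (hg : MemLp g q μ)
    (hfg : ∀ x, g x = ∑ i ∈ s, f i x) : hg.toLp g = ∑ i ∈ s, (hf i).toLp (f i) := by
  classical
  induction s using Finset.induction_on generalizing g with
  | empty =>
    ext1
    filter_upwards [hg.coeFn_toLp, Lp.coeFn_zero E q μ] with x h1 h2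
    rw [h1, hfg, Finset.sum_empty, Finset.sum_empty, h2, Pi.zero_apply]
  | insert a s ha ih =>
    have hs : MemLp (fun x => ∑ i ∈ s, f i x) q μ := memLp_finsetSum s fun i _ => hf i
    rw [Finset.sum_insert ha, ← ih hs fun x => rfl, ← MemLp.toLp_add]
    exact MemLp.toLp_congr _ _ (ae_of_all _ fun x => by simp [hfg, Finset.sum_insert ha])

lemma dense_span_indicatorConstLp (𝕜 : Type*) [RCLike 𝕜] :
    Dense (Submodule.span 𝕜 (Set.range fun B : {B : Set α // MeasurableSet B ∧ μ B ≠ ∞} =>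
      indicatorConstLp 2 B.2.1 B.2.2 (1 : 𝕜)) : Set (Lp 𝕜 2 μ)) := by
  set M := Submodule.span 𝕜 (Set.range fun B : {B : Set α // MeasurableSet B ∧ μ B ≠ ∞} =>
      indicatorConstLp 2 B.2.1 B.2.2 (1 : 𝕜))
  rw [Submodule.dense_iff_topologicalClosure_eq_top, eq_top_iff]
  rintro f -
  refine Lp.induction (by norm_num) (fun f => f ∈ M.topologicalClosure) ?_ ?_ ?_ f
  · intro c s hs hμs
    have : (Lp.simpleFunc.indicatorConst 2 hs hμs.ne c : Lp 𝕜 2 μ) =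
        c • indicatorConstLp 2 hs hμs.ne (1 : 𝕜) := by
      rw [Lp.simpleFunc.coe_indicatorConst]
      ext1
      filter_upwards [indicatorConstLp_coeFn (p := 2) (hs := hs) (hμs := hμs.ne) (c := c),
        Lp.coeFn_smul c (indicatorConstLp 2 hs hμs.ne (1 : 𝕜)),
        indicatorConstLp_coeFn (p := 2) (hs := hs) (hμs := hμs.ne) (c := (1 : 𝕜))] with x h1 h2 h3
      rw [h1, h2, Pi.smul_apply, h3]
      by_cases hx : x ∈ s <;> simp [hx]
    rw [this]
    exact M.le_topologicalClosure (M.smul_mem _ (Submodule.subset_span ⟨⟨s, hs, hμs.ne⟩, rfl⟩))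
  · intro f g _ _ _ h1 h2
    exact Submodule.add_mem _ h1 h2
  · exact M.isClosed_topologicalClosure

lemma inner_indicatorConstLp_one_eq {𝕜 : Type*} [RCLike 𝕜] {B C : Set α} (hB : MeasurableSet B)
    (hC : MeasurableSet C) (hfB : μ B ≠ ∞) (hfC : μ C ≠ ∞) :
    inner 𝕜 (indicatorConstLp 2 hB hfB (1 : 𝕜)) (indicatorConstLp 2 hC hfC (1 : 𝕜)) =
      (((μ (B ∩ C)).toReal : ℝ) : 𝕜) := by
  have e : (fun a => inner 𝕜 ((indicatorConstLp 2 hB hfB (1 : 𝕜)) a)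
      ((indicatorConstLp 2 hC hfC (1 : 𝕜)) a)) =ᵐ[μ]
      (B ∩ C).indicator fun _ => (1 : 𝕜) := by
    filter_upwards [indicatorConstLp_coeFn (p := 2) (hs := hB) (hμs := hfB) (c := (1 : 𝕜)),
      indicatorConstLp_coeFn (p := 2) (hs := hC) (hμs := hfC) (c := (1 : 𝕜))] with x h1 h2
    rw [h1, h2]
    by_cases h3 : x ∈ B <;> by_cases h4 : x ∈ C <;> simp [h3, h4]
  rw [L2.inner_def, integral_congr_ae e, integral_indicator (hB.inter hC)]
  simp [Measure.real, RCLike.real_smul_eq_coe_mul]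

/-- Pointwise complex conjugation on `L²`. -/
def conjL (μ : Measure α) : Lp ℂ 2 μ →L[ℝ] Lp ℂ 2 μ :=
  (Complex.conjCLE : ℂ →L[ℝ] ℂ).compLpL 2 μ

lemma coeFn_conjL (f : Lp ℂ 2 μ) : conjL μ f =ᵐ[μ] fun x => (starRingEnd ℂ) (f x) := by
  filter_upwards [(Complex.conjCLE : ℂ →L[ℝ] ℂ).coeFn_compLpL f] with x hx
  exact hx

lemma conjL_smul (c : ℂ) (f : Lp ℂ 2 μ) : conjL μ (c • f) = (starRingEnd ℂ) c • conjL μ f := by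
  ext1
  filter_upwards [coeFn_conjL (c • f), coeFn_conjL f, Lp.coeFn_smul c f,
    Lp.coeFn_smul ((starRingEnd ℂ) c) (conjL μ f)] with x h1 h2 h3 h4
  simp [h1, h2, h3, h4]

lemma conjL_conjL (f : Lp ℂ 2 μ) : conjL μ (conjL μ f) = f := by
  ext1
  filter_upwards [coeFn_conjL (conjL μ f), coeFn_conjL f] with x h1 h2
  simp [h1, h2]

lemma ofReal_re_of_conjL_eq {f : Lp ℂ 2 μ} (hf : conjL μ f = f) :
    ∀ᵐ x ∂μ, (((f x).re : ℝ) : ℂ) = f x := by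
  have := coeFn_conjL f
  rw [hf] at this
  filter_upwards [this] with x hx
  exact Complex.conj_eq_iff_re.1 hx.symm

end LpLemmas

/-! ### The scalar Poisson integral as an isometry -/

section PoissonIntegral

variable {S Ω : Type*} [MeasurableSpace S] [MeasurableSpace Ω] {N : Ω → Measure S}
  {ν : Measure S} {P : Measure Ω}

lemma IsPoissonRandomMeasure.memLp_ofReal_compensated [IsProbabilityMeasure P]
    (h : IsPoissonRandomMeasure N ν P)
    {B : Set S} (hB : MeasurableSet B) (hf : ν B ≠ ∞) :
    MemLp (fun ω => (compensated N ν B ω : ℂ)) 2 P :=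
  (h.memLp_compensated hB hf).ofReal

/-- Indicators in L²(ν) and compensated counts in L²(P) both have Gram matrix ν(B ∩ C), and the
indicators are total. -/
lemma IsPoissonRandomMeasure.exists_integral [IsProbabilityMeasure P]
    (h : IsPoissonRandomMeasure N ν P) :
    ∃ I : Lp ℂ 2 ν →L[ℂ] Lp ℂ 2 P,
      (∀ (B : Set S) (hB : MeasurableSet B) (hf : ν B ≠ ∞), I (indicatorConstLp 2 hB hf 1) =
        (h.memLp_ofReal_compensated hB hf).toLp _) ∧
      ∀ f g, inner ℂ (I f) (I g) = inner ℂ f g := by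
  have hG : ∀ B C : {B : Set S // MeasurableSet B ∧ ν B ≠ ∞},
      inner ℂ (indicatorConstLp 2 B.2.1 B.2.2 (1 : ℂ)) (indicatorConstLp 2 C.2.1 C.2.2 (1 : ℂ)) =
      inner ℂ ((h.memLp_ofReal_compensated B.2.1 B.2.2).toLp _)
        ((h.memLp_ofReal_compensated C.2.1 C.2.2).toLp _) := by
    rintro ⟨B, hB, hfB⟩ ⟨C, hC, hfC⟩
    have e : (fun ω => inner ℂ ((h.memLp_ofReal_compensated hB hfB).toLp _ ω)
        ((h.memLp_ofReal_compensated hC hfC).toLp _ ω)) =ᵐ[P]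
        fun ω => ((compensated N ν B ω * compensated N ν C ω : ℝ) : ℂ) := by
      filter_upwards [(h.memLp_ofReal_compensated hB hfB).coeFn_toLp,
        (h.memLp_ofReal_compensated hC hfC).coeFn_toLp] with ω h1 h2
      simp [h1, h2, mul_comm]
    rw [inner_indicatorConstLp_one_eq, L2.inner_def, integral_congr_ae e, integral_complex_ofReal,
      h.integral_compensated_mul hB hC hfB hfC]
    rfl
  obtain ⟨I, h1, h2⟩ := exists_clm_of_inner_eq (𝕜 := ℂ) _ _ hG (dense_span_indicatorConstLp ℂ)
  exact ⟨I, fun B hB hf => h1 ⟨B, hB, hf⟩, h2⟩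

variable [IsProbabilityMeasure P] (h : IsPoissonRandomMeasure N ν P)

/-- The integral with respect to the compensated Poisson random measure, as an isometry from
`L²(ν)` to `L²(P)`. -/
def IsPoissonRandomMeasure.integral : Lp ℂ 2 ν →L[ℂ] Lp ℂ 2 P := h.exists_integral.choose

lemma IsPoissonRandomMeasure.integral_indicator {B : Set S} (hB : MeasurableSet B)
    (hf : ν B ≠ ∞) : h.integral (indicatorConstLp 2 hB hf 1) =
      (h.memLp_ofReal_compensated hB hf).toLp _ :=
  h.exists_integral.choose_spec.1 B hB hf

lemma IsPoissonRandomMeasure.inner_integral (f g : Lp ℂ 2 ν) :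
    inner ℂ (h.integral f) (h.integral g) = inner ℂ f g :=
  h.exists_integral.choose_spec.2 f g

/-- Continuous (semi)linear maps on `L²` which agree on indicators are equal. -/
lemma eq_of_eq_indicator {V : Type*} [AddCommGroup V] [Module ℂ V] [TopologicalSpace V]
    [T2Space V] {σ : ℂ →+* ℂ} {T U : Lp ℂ 2 ν → V} (hT : Continuous T) (hU : Continuous U)
    (hT0 : T 0 = 0) (hU0 : U 0 = 0)
    (hTa : ∀ f g, T (f + g) = T f + T g) (hUa : ∀ f g, U (f + g) = U f + U g)
    (hTs : ∀ (c : ℂ) f, T (c • f) = σ c • T f) (hUs : ∀ (c : ℂ) f, U (c • f) = σ c • U f)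
    (hTU : ∀ (B : Set S) (hB : MeasurableSet B) (hf : ν B ≠ ∞),
      T (indicatorConstLp 2 hB hf 1) = U (indicatorConstLp 2 hB hf 1)) : T = U := by
  refine hT.ext_on (dense_span_indicatorConstLp ℂ) hU fun f hf => ?_
  induction hf using Submodule.span_induction with
  | mem f hf => obtain ⟨B, rfl⟩ := hf; exact hTU B B.2.1 B.2.2
  | zero => rw [hT0, hU0]
  | add f g _ _ h1 h2 => rw [hTa, hUa, h1, h2]
  | smul c f _ h1 => rw [hTs, hUs, h1]

/-- Compensated counts are real, so the two conjugate-linear maps agree on indicators. -/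
lemma IsPoissonRandomMeasure.conjL_integral (f : Lp ℂ 2 ν) :
    conjL P (h.integral f) = h.integral (conjL ν f) := by
  refine congrFun (eq_of_eq_indicator (σ := starRingEnd ℂ)
    (T := fun f => conjL P (h.integral f)) (U := fun f => h.integral (conjL ν f))
    (by fun_prop) (by fun_prop) (by simp) (by simp) (by simp) (by simp)
    (by simp [conjL_smul]) (by simp [conjL_smul]) fun B hB hf => ?_) f
  have e : conjL ν (indicatorConstLp 2 hB hf 1) = indicatorConstLp 2 hB hf 1 := by
    ext1
    filter_upwards [coeFn_conjL (indicatorConstLp 2 hB hf (1 : ℂ)),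
      indicatorConstLp_coeFn (p := 2) (hs := hB) (hμs := hf) (c := (1 : ℂ))] with x h1 h2
    rw [h1, h2]
    by_cases hx : x ∈ B <;> simp [hx]
  simp only [e, h.integral_indicator]
  ext1
  filter_upwards [coeFn_conjL ((h.memLp_ofReal_compensated hB hf).toLp _),
    (h.memLp_ofReal_compensated hB hf).coeFn_toLp] with x h1 h2
  rw [h1, h2, Complex.conj_ofReal]

/-- The mean is the inner product with the constant 1, hence continuous in f, and it vanishes on
indicators. -/
lemma IsPoissonRandomMeasure.integral_integral_eq_zero (f : Lp ℂ 2 ν) :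
    ∫ ω, h.integral f ω ∂P = 0 := by
  have key : ∀ g : Lp ℂ 2 P, ∫ ω, g ω ∂P =
      inner ℂ (indicatorConstLp 2 MeasurableSet.univ (measure_ne_top P _) (1 : ℂ)) g := fun g => by
    rw [L2.inner_indicatorConstLp_one, setIntegral_univ]
  rw [key]
  refine congrFun (eq_of_eq_indicator (σ := RingHom.id ℂ) (U := fun _ => (0 : ℂ))
    (T := fun f => inner ℂ (indicatorConstLp 2 MeasurableSet.univ (measure_ne_top P _) (1 : ℂ))
      (h.integral f))
    (by fun_prop) (by fun_prop) (by simp) (by simp) (by simp [inner_add_right]) (by simp)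
    (by simp [inner_smul_right]) (by simp) fun B hB hf => ?_) f
  rw [← key, h.integral_indicator, integral_congr_ae (MemLp.coeFn_toLp _),
    integral_complex_ofReal, h.integral_compensated hB hf, Complex.ofReal_zero]

end PoissonIntegral

/-! ### Coordinates of vector-valued Poisson integrals -/

section IsPoissonIntegral

variable {Ω : Type*} [MeasurableSpace Ω] {P : Measure Ω} {𝕜 : Type*} [RCLike 𝕜] {p : ℕ}

/-- The real-linear map `e` covers at once the inclusion ℝ ⊆ ℂ, needed for (i), and the identity and
conjugation of ℂ, needed for (ii). -/
lemma memLp_clm_apply {α : Type*} [MeasurableSpace α] {μ : Measure α}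
    {f : α → EuclideanSpace 𝕜 (Fin p)} (hf : MemLp f 2 μ) (e : 𝕜 →L[ℝ] ℂ) (i : Fin p) :
    MemLp (fun x => e (f x i)) 2 μ :=
  ((e.comp ((EuclideanSpace.proj i : EuclideanSpace 𝕜 (Fin p) →L[𝕜] 𝕜).restrictScalars
    ℝ)).comp_memLp' hf)

lemma tendsto_toLp_clm_apply {α : Type*} [MeasurableSpace α] {μ : Measure α}
    {F : ℕ → α → EuclideanSpace 𝕜 (Fin p)} {f : α → EuclideanSpace 𝕜 (Fin p)}
    (hF : ∀ k, MemLp (F k) 2 μ) (hf : MemLp f 2 μ)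
    (h : Tendsto (fun k => eLpNorm (fun x => F k x - f x) 2 μ) atTop (𝓝 0))
    (e : 𝕜 →L[ℝ] ℂ) (i : Fin p) :
    Tendsto (fun k => (memLp_clm_apply (hF k) e i).toLp _) atTop
      (𝓝 ((memLp_clm_apply hf e i).toLp _)) := by
  rw [Lp.tendsto_Lp_iff_tendsto_eLpNorm'']
  have hb : ∀ k, eLpNorm ((fun x => e (F k x i)) - fun x => e (f x i)) 2 μ ≤
      ENNReal.ofReal ‖e‖ * eLpNorm (fun x => F k x - f x) 2 μ := fun k => by
    refine eLpNorm_le_mul_eLpNorm_of_ae_le_mul (ae_of_all _ fun x => ?_) 2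
    rw [Pi.sub_apply, ← map_sub]
    refine (e.le_opNorm _).trans (mul_le_mul_of_nonneg_left ?_ (norm_nonneg _))
    exact PiLp.norm_apply_le (F k x - f x) i
  refine tendsto_of_tendsto_of_tendsto_of_le_of_le tendsto_const_nhds ?_ (fun _ => zero_le) hb
  simpa only [mul_zero] using ENNReal.Tendsto.const_mul h (Or.inr ENNReal.ofReal_ne_top)

lemma StepFn.memLp_eval {S W : Type*} [MeasurableSpace S] {ν : Measure S} [NormedAddCommGroup W]
    (F : StepFn S ν W) : MemLp F.eval 2 ν :=
  memLp_finsetSum _ fun j _ => memLp_indicator_const 2 (F.measurableSet j) _ (Or.inr (F.finite j))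

section StepFn

variable {S : Type*} [MeasurableSpace S] {ν : Measure S} [IsProbabilityMeasure P]
  {N : Ω → Measure S}

lemma StepFn.memLp_poissonInt (h : IsPoissonRandomMeasure N ν P)
    (F : StepFn S ν (EuclideanSpace 𝕜 (Fin p))) : MemLp (F.poissonInt N) 2 P := by
  refine memLp_finsetSum _ fun j _ => ?_
  exact (ContinuousLinearMap.toSpanSingleton 𝕜 (F.coef j)).comp_memLp'
    ((h.memLp_compensated (F.measurableSet j) (F.finite j)).ofReal (K := 𝕜))

lemma StepFn.integral_toLp_eval (h : IsPoissonRandomMeasure N ν P)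
    (F : StepFn S ν (EuclideanSpace 𝕜 (Fin p))) (e : 𝕜 →L[ℝ] ℂ) (i : Fin p) :
    h.integral ((memLp_clm_apply F.memLp_eval e i).toLp _) =
      (memLp_clm_apply (StepFn.memLp_poissonInt h F) e i).toLp _ := by
  have ha : (memLp_clm_apply F.memLp_eval e i).toLp _ = ∑ j, e (F.coef j i) •
      indicatorConstLp 2 (F.measurableSet j) (F.finite j) (1 : ℂ) := by
    have hi : ∀ j, MemLp ((F.set j).indicator fun _ => (1 : ℂ)) 2 ν := fun j =>
      memLp_indicator_const 2 (F.measurableSet j) (1 : ℂ) (Or.inr (F.finite j))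
    refine (toLp_finsetSum Finset.univ (fun j => (hi j).const_smul (e (F.coef j i))) _
      fun x => ?_).trans (Finset.sum_congr rfl fun j _ => ?_)
    · simp only [StepFn.eval, WithLp.ofLp_sum, Finset.sum_apply, map_sum]
      refine Finset.sum_congr rfl fun j _ => ?_
      by_cases hx : x ∈ F.set j <;> simp [hx]
    · rw [MemLp.toLp_const_smul]; rfl
  have hb : (memLp_clm_apply (StepFn.memLp_poissonInt h F) e i).toLp _ = ∑ j, e (F.coef j i) •
      (h.memLp_ofReal_compensated (F.measurableSet j) (F.finite j)).toLp _ := by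
    refine (toLp_finsetSum Finset.univ (fun j => (h.memLp_ofReal_compensated (F.measurableSet j)
      (F.finite j)).const_smul (e (F.coef j i))) _
      fun x => ?_).trans (Finset.sum_congr rfl fun j _ => ?_)
    · simp only [StepFn.poissonInt, WithLp.ofLp_sum, Finset.sum_apply, map_sum]
      refine Finset.sum_congr rfl fun j _ => ?_
      rw [PiLp.smul_apply, ← RCLike.real_smul_eq_coe_smul, map_smul]
      simp [compensated, mul_comm]
    · rw [MemLp.toLp_const_smul]
  rw [ha, hb, map_sum]
  simp only [map_smul, h.integral_indicator]

end StepFn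

/-- The coordinates of a Poisson integral are the scalar Poisson integrals of the coordinates. -/
lemma IsPoissonIntegral.integral_toLp_eq [IsProbabilityMeasure P]
    {N : Ω → Measure (ℝ × EuclideanSpace 𝕜 (Fin p))} {μ : Measure (EuclideanSpace 𝕜 (Fin p))}
    (h : IsPoissonRandomMeasure N ((volume : Measure ℝ).prod μ) P)
    {φ : ℝ × EuclideanSpace 𝕜 (Fin p) → EuclideanSpace 𝕜 (Fin p)}
    {Y : Ω → EuclideanSpace 𝕜 (Fin p)} (hY : IsPoissonIntegral N μ P φ Y)
    (e : 𝕜 →L[ℝ] ℂ) (i : Fin p) :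
    h.integral ((memLp_clm_apply hY.1 e i).toLp _) = (memLp_clm_apply hY.2.1 e i).toLp _ := by
  -- The rectangular shape of the sets is dropped: the isometry is defined on all of L², so any
  -- approximating step functions give the same limit.
  obtain ⟨hφ, hYm, F, -, h1, h2⟩ := hY
  have t1 := (h.integral.continuous.tendsto _).comp
    (tendsto_toLp_clm_apply (fun k => (F k).memLp_eval) hφ h1 e i)
  have t2 := tendsto_toLp_clm_apply (fun k => StepFn.memLp_poissonInt h (F k)) hYm h2 e i
  exact tendsto_nhds_unique t1 (t2.congr fun k => (StepFn.integral_toLp_eval h (F k) e i).symm)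

end IsPoissonIntegral

/-! ### Coordinatewise convergence and cross moments -/

section VectorL2

variable {Ω : Type*} [MeasurableSpace Ω] {P : Measure Ω} {𝕜 : Type*} [RCLike 𝕜] {p : ℕ}

lemma norm_le_sum_norm_apply (v : EuclideanSpace 𝕜 (Fin p)) : ‖v‖ ≤ ∑ i, ‖v i‖ := by
  conv_lhs => rw [← (EuclideanSpace.basisFun (Fin p) 𝕜).sum_repr v]
  refine (norm_sum_le _ _).trans (Finset.sum_le_sum fun i _ => ?_)
  simp [norm_smul]

lemma tendsto_eLpNorm_of_eval {G : ℕ → Ω → EuclideanSpace 𝕜 (Fin p)}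
    (hm : ∀ k i, AEStronglyMeasurable (fun ω => G k ω i) P)
    (h : ∀ i, Tendsto (fun k => eLpNorm (fun ω => G k ω i) 2 P) atTop (𝓝 0)) :
    Tendsto (fun k => eLpNorm (G k) 2 P) atTop (𝓝 0) := by
  have hb : ∀ k, eLpNorm (G k) 2 P ≤ ∑ i, eLpNorm (fun ω => G k ω i) 2 P := fun k => by
    calc eLpNorm (G k) 2 P ≤ eLpNorm (∑ i, fun ω => ‖G k ω i‖) 2 P := by
          refine eLpNorm_mono fun ω => (norm_le_sum_norm_apply _).trans ?_
          rw [Finset.sum_apply]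
          exact le_abs_self _
      _ ≤ ∑ i, eLpNorm (fun ω => ‖G k ω i‖) 2 P :=
          eLpNorm_sum_le (fun i _ => (hm k i).norm) (by norm_num)
      _ = _ := by simp only [eLpNorm_norm]
  refine tendsto_of_tendsto_of_tendsto_of_le_of_le tendsto_const_nhds ?_ (fun _ => zero_le) hb
  simpa using tendsto_finsetSum Finset.univ fun i _ => h i

lemma crossMoment_apply {U V : Ω → EuclideanSpace 𝕜 (Fin p)} (i j : Fin p) {f g : Lp 𝕜 2 P}
    (hU : (fun ω => U ω i) =ᵐ[P] f) (hV : (fun ω => V ω j) =ᵐ[P] g) :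
    crossMoment P U V i j = inner 𝕜 g f := by
  rw [crossMoment, Matrix.of_apply, L2.inner_def]
  refine integral_congr_ae ?_
  filter_upwards [hU, hV] with ω h1 h2
  rw [h1, h2, RCLike.inner_apply, mul_comm]

end VectorL2

/-! ### Approximation of matrix functions by step functions -/

section StepApproximation

variable {𝕜 : Type*} [RCLike 𝕜] {p : ℕ}

lemma exists_stepFn_eLpNorm_sub_lt {f : ℝ → Matrix (Fin p) (Fin p) 𝕜}
    (hf : ∀ i j, MemLp (fun x => f x i j) 2 (volume : Measure ℝ)) {ε : ℝ≥0∞} (hε : ε ≠ 0) :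
    ∃ F : StepFn ℝ volume (Matrix (Fin p) (Fin p) 𝕜), ∀ i j,
      eLpNorm (fun x => F.eval x i j - f x i j) 2 (volume : Measure ℝ) < ε := by
  -- Matrices are read as iterated functions, whose sup norm dominates every entry.
  have hf' : MemLp (ε := Fin p → Fin p → 𝕜) f 2 (volume : Measure ℝ) :=
    MemLp.of_eval fun i => MemLp.of_eval fun j => hf i j
  obtain ⟨g, hg, hgm⟩ := hf'.exists_simpleFunc_eLpNorm_sub_lt (by norm_num) hε
  classical
  -- The value 0 is discarded because its fibre may have infinite measure.
  set T := g.range.filter (· ≠ 0)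
  let F : StepFn ℝ volume (Matrix (Fin p) (Fin p) 𝕜) :=
    { n := T.card
      coef := fun k => ((T.equivFin.symm k : T) : Fin p → Fin p → 𝕜)
      set := fun k => g ⁻¹' {((T.equivFin.symm k : T) : Fin p → Fin p → 𝕜)}
      measurableSet := fun k => g.measurableSet_fiber _
      finite := fun k => (g.measure_preimage_lt_top_of_memLp (by norm_num) (by norm_num) hgm _
        (Finset.mem_filter.1 (T.equivFin.symm k).2).2).ne }
  have hF : ∀ x, F.eval x = g x := fun x => by
    have h1 : F.eval x = ∑ k : T, (g ⁻¹' {(k : Fin p → Fin p → 𝕜)}).indicator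
        (fun _ => (k : Fin p → Fin p → 𝕜)) x := T.equivFin.symm.sum_comp
      (fun k : T => (g ⁻¹' {(k : Fin p → Fin p → 𝕜)}).indicator
        (fun _ => (k : Fin p → Fin p → 𝕜)) x)
    rw [h1, Finset.sum_coe_sort T fun c => (g ⁻¹' {c}).indicator (fun _ => c) x]
    simp only [Set.indicator_apply, Set.mem_preimage, Set.mem_singleton_iff]
    rw [Finset.sum_ite_eq T (g x)]
    split_ifs with hx
    · rfl
    · by_contra h0
      exact hx (Finset.mem_filter.2 ⟨g.mem_range_self x, fun h => h0 h.symm⟩)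
  refine ⟨F, fun i j => lt_of_le_of_lt (eLpNorm_mono fun x => ?_) hg⟩
  rw [hF, norm_sub_rev]
  exact (norm_le_pi_norm (fun j => f x i j - g x i j) j).trans
    (norm_le_pi_norm (fun i j => f x i j - g x i j) i)

lemma exists_seq_stepFn {f : ℝ → Matrix (Fin p) (Fin p) 𝕜}
    (hf : ∀ i j, MemLp (fun x => f x i j) 2 (volume : Measure ℝ)) :
    ∃ F : ℕ → StepFn ℝ volume (Matrix (Fin p) (Fin p) 𝕜), ∀ i j,
      Tendsto (fun k => eLpNorm (fun x => (F k).eval x i j - f x i j) 2 (volume : Measure ℝ))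
        atTop (𝓝 0) := by
  choose F hF using fun k : ℕ => exists_stepFn_eLpNorm_sub_lt hf
    (ε := ((k : ℝ≥0∞) + 1)⁻¹) (by simp)
  refine ⟨F, fun i j => tendsto_of_tendsto_of_tendsto_of_le_of_le tendsto_const_nhds ?_
    (fun _ => zero_le) fun k => (hF k i j).le⟩
  have := (tendsto_add_atTop_iff_nat 1).2 ENNReal.tendsto_inv_nat_nhds_zero
  simpa using this

end StepApproximation

/-! ### Orthogonal random measures from families of isometries -/

section OrthogonalMeasure

variable {Ω : Type*} [MeasurableSpace Ω] {P : Measure Ω} {𝕜 : Type*} [RCLike 𝕜] {p : ℕ}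

open Classical in
/-- The random measure `B ↦ (K i 1_B)_i` induced by operators `K i : L²(ℝ) → L²(P)`. -/
def orthMeasure (K : Fin p → (Lp 𝕜 2 (volume : Measure ℝ) →L[𝕜] Lp 𝕜 2 P)) (B : Set ℝ) (ω : Ω) :
    EuclideanSpace 𝕜 (Fin p) :=
  if h : MeasurableSet B ∧ volume B ≠ ∞ then
    WithLp.toLp 2 fun i => K i (indicatorConstLp 2 h.1 h.2 1) ω
  else 0

variable {K : Fin p → (Lp 𝕜 2 (volume : Measure ℝ) →L[𝕜] Lp 𝕜 2 P)}

lemma orthMeasure_apply {B : Set ℝ} (hB : MeasurableSet B) (hf : volume B ≠ ∞) (i : Fin p) :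
    (fun ω => orthMeasure K B ω i) = K i (indicatorConstLp 2 hB hf 1) := by
  funext ω
  simp [orthMeasure, hB, hf]

lemma memLp_orthMeasure {B : Set ℝ} (hB : MeasurableSet B) (hf : volume B ≠ ∞) :
    MemLp (orthMeasure K B) 2 P := by
  refine MemLp.of_eval_piLp fun i => ?_
  rw [orthMeasure_apply hB hf]
  exact Lp.memLp _

/-- By disjointness the partial sums are indicators of partial unions; these differ from the full
union by a tail whose measure tends to 0. Continuity of `K i` turns this into countable additivity
in L²(P). -/
lemma tendsto_sum_indicatorConstLp {B : ℕ → Set ℝ} (hB : ∀ n, MeasurableSet (B n))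
    (hd : Pairwise (Function.onFun Disjoint B)) (hf : volume (⋃ n, B n) ≠ ∞) :
    Tendsto (fun n => ∑ k ∈ Finset.range n, indicatorConstLp 2 (hB k)
      (measure_ne_top_of_subset (Set.subset_iUnion B k) hf) (1 : 𝕜)) atTop
      (𝓝 (indicatorConstLp 2 (MeasurableSet.iUnion hB) hf (1 : 𝕜))) := by
  have hm : ∀ n, MeasurableSet (⋃ k ∈ Finset.range n, B k) := fun n =>
    Finset.measurableSet_biUnion _ fun k _ => hB k
  have hs : ∀ n, (⋃ k ∈ Finset.range n, B k) ⊆ ⋃ n, B n := fun n =>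
    Set.iUnion₂_subset fun k _ => Set.subset_iUnion B k
  have ht : ∀ n, volume (⋃ k ∈ Finset.range n, B k) ≠ ∞ := fun n =>
    measure_ne_top_of_subset (hs n) hf
  have key : ∀ n, ∑ k ∈ Finset.range n, indicatorConstLp 2 (hB k)
      (measure_ne_top_of_subset (Set.subset_iUnion B k) hf) (1 : 𝕜) =
      indicatorConstLp 2 (hm n) (ht n) (1 : 𝕜) := fun n => by
    refine (toLp_finsetSum _ (fun k => memLp_indicator_const 2 (hB k) (1 : 𝕜)
      (Or.inr (measure_ne_top_of_subset (Set.subset_iUnion B k) hf))) _ fun x => ?_).symm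
    rw [Finset.indicator_biUnion_apply]
    exact fun i _ j _ hij => hd hij
  simp only [key]
  refine tendsto_indicatorConstLp_set (by norm_num) ?_
  have e : ∀ n, symmDiff (⋃ k ∈ Finset.range n, B k) (⋃ n, B n) =
      (⋃ n, B n) \ ⋃ k ∈ Finset.range n, B k := fun n => by
    rw [Set.symmDiff_def, Set.sdiff_eq_empty.2 (hs n), Set.empty_union]
  simp only [e]
  have hmono : Monotone fun n => ⋃ k ∈ Finset.range n, B k := fun m n hmn =>
    Set.biUnion_subset_biUnion_left fun k hk =>
      Finset.mem_range.2 ((Finset.mem_range.1 hk).trans_le hmn)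
  have hU : ⋃ n, ⋃ k ∈ Finset.range n, B k = ⋃ n, B n := by
    refine Set.Subset.antisymm (Set.iUnion_subset hs) (Set.iUnion_subset fun k => ?_)
    exact Set.subset_iUnion_of_subset (k + 1) (Set.subset_biUnion_of_mem (u := B)
      (Finset.mem_coe.2 (Finset.self_mem_range_succ k)))
  have h1 := tendsto_measure_iUnion_atTop (μ := (volume : Measure ℝ)) hmono
  rw [hU] at h1
  have h2 := ENNReal.Tendsto.sub (tendsto_const_nhds (x := volume (⋃ n, B n))) h1 (Or.inl hf)
  rw [tsub_self] at h2
  refine h2.congr fun n => ?_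
  rw [measure_sdiff (hs n) (hm n).nullMeasurableSet (ht n), Function.comp_apply]

/-- Operators with orthogonal centred isometric coordinates induce an orthogonal-increment random
measure. -/
lemma isOrthogonalRandomMeasure_orthMeasure [IsFiniteMeasure P]
    (hK : ∀ i j f g, inner 𝕜 (K i f) (K j g) = if i = j then inner 𝕜 f g else 0)
    (hmean : ∀ i f, ∫ ω, K i f ω ∂P = 0) : IsOrthogonalRandomMeasure (orthMeasure K) P where
  memLp B hB hf := memLp_orthMeasure hB hf
  additive B hB hd hf := by
    have hfn : ∀ n, volume (B n) ≠ ∞ := fun n =>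
      measure_ne_top_of_subset (Set.subset_iUnion B n) hf
    have e : ∀ n i, (fun ω => ((∑ k ∈ Finset.range n, orthMeasure K (B k) ω) -
        orthMeasure K (⋃ n, B n) ω) i) =ᵐ[P]
        (K i (∑ k ∈ Finset.range n, indicatorConstLp 2 (hB k) (hfn k) (1 : 𝕜)) : Ω → 𝕜) -
          K i (indicatorConstLp 2 (MeasurableSet.iUnion hB) hf (1 : 𝕜)) := fun n i => by
      rw [map_sum]
      filter_upwards [Lp.coeFn_finsetSum (Finset.range n)
        fun k => K i (indicatorConstLp 2 (hB k) (hfn k) (1 : 𝕜))] with ω h1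
      rw [Pi.sub_apply, h1, Finset.sum_apply, PiLp.sub_apply, WithLp.ofLp_sum, Finset.sum_apply]
      simp only [← orthMeasure_apply]
    refine tendsto_eLpNorm_of_eval (fun n i => ?_) fun i => ?_
    · exact (((Lp.memLp _).sub (Lp.memLp _)).ae_eq (e n i).symm).aestronglyMeasurable
    · have := ((K i).continuous.tendsto _).comp (tendsto_sum_indicatorConstLp (𝕜 := 𝕜) hB hd hf)
      rw [Lp.tendsto_Lp_iff_tendsto_eLpNorm'] at this
      exact this.congr fun n => (eLpNorm_congr_ae (e n i)).symm
  mean_zero B hB hf := by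
    ext i
    have hi : Integrable (orthMeasure K B) P :=
      (memLp_orthMeasure hB hf).integrable (by norm_num)
    rw [eval_integral_piLp fun i => hi.eval_piLp i]
    have := hmean i (indicatorConstLp 2 hB hf 1)
    rwa [← orthMeasure_apply] at this
  orthogonal B C hB hC hfB hfC hd := by
    ext i j
    rw [crossMoment_apply i j (.of_eq (orthMeasure_apply hB hfB i))
      (.of_eq (orthMeasure_apply hC hfC j)), hK, inner_indicatorConstLp_one_eq,
      Set.disjoint_iff_inter_eq_empty.1 hd.symm]
    simp
  control B hB hf := by
    ext i j
    rw [crossMoment_apply i j (.of_eq (orthMeasure_apply hB hf i))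
      (.of_eq (orthMeasure_apply hB hf j)), hK, inner_indicatorConstLp_one_eq, Set.inter_self]
    by_cases hij : i = j
    · simp [hij]
    · simp [hij, Ne.symm hij]

lemma StepFn.orthInt_apply (F : StepFn ℝ volume (Matrix (Fin p) (Fin p) 𝕜)) (i : Fin p)
    (hF : ∀ j, MemLp (fun x => F.eval x i j) 2 (volume : Measure ℝ)) :
    (fun ω => F.orthInt (orthMeasure K) ω i) =ᵐ[P] (∑ j, K j ((hF j).toLp _) : Lp 𝕜 2 P) := by
  have e : ∀ j, (hF j).toLp _ = ∑ k, F.coef k i j •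
      indicatorConstLp 2 (F.measurableSet k) (F.finite k) (1 : 𝕜) := fun j => by
    refine (toLp_finsetSum Finset.univ (fun k => (memLp_indicator_const 2 (F.measurableSet k)
      (1 : 𝕜) (Or.inr (F.finite k))).const_smul (F.coef k i j)) _
      fun x => ?_).trans (Finset.sum_congr rfl fun k _ => ?_)
    · simp only [StepFn.eval, Matrix.sum_apply]
      refine Finset.sum_congr rfl fun k _ => ?_
      by_cases hx : x ∈ F.set k <;> simp [hx]
    · rw [MemLp.toLp_const_smul]; rfl
  simp only [e, map_sum, map_smul]
  rw [Finset.sum_comm]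
  have h1 := Lp.coeFn_finsetSum Finset.univ fun k => ∑ j, F.coef k i j •
    K j (indicatorConstLp 2 (F.measurableSet k) (F.finite k) (1 : 𝕜))
  have h2 := fun k => Lp.coeFn_finsetSum Finset.univ fun j => F.coef k i j •
    K j (indicatorConstLp 2 (F.measurableSet k) (F.finite k) (1 : 𝕜))
  have h3 := fun k j => Lp.coeFn_smul (F.coef k i j)
    (K j (indicatorConstLp 2 (F.measurableSet k) (F.finite k) (1 : 𝕜)))
  filter_upwards [h1, ae_all_iff.2 h2, ae_all_iff.2 fun k => ae_all_iff.2 (h3 k)] with ω g1 g2 g3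
  rw [g1, StepFn.orthInt, WithLp.ofLp_sum, Finset.sum_apply, Finset.sum_apply]
  refine Finset.sum_congr rfl fun k _ => ?_
  rw [g2, Finset.sum_apply]
  simp only [matVec, Matrix.mulVec, dotProduct]
  refine Finset.sum_congr rfl fun j _ => ?_
  rw [g3, Pi.smul_apply, smul_eq_mul, ← orthMeasure_apply]

/-- The identity holds for step functions by `StepFn.orthInt_apply` and passes to the limit because
each `K j` is continuous. -/
lemma isOrthIntegral_orthMeasure {f : ℝ → Matrix (Fin p) (Fin p) 𝕜}
    (hf : ∀ i j, MemLp (fun x => f x i j) 2 (volume : Measure ℝ))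
    {Y : Ω → EuclideanSpace 𝕜 (Fin p)}
    (hY : ∀ i, (fun ω => Y ω i) =ᵐ[P] (∑ j, K j ((hf i j).toLp _) : Lp 𝕜 2 P)) :
    IsOrthIntegral (orthMeasure K) P f Y := by
  obtain ⟨F, hF⟩ := exists_seq_stepFn hf
  have hE : ∀ k i j, MemLp (fun x => (F k).eval x i j) 2 (volume : Measure ℝ) := fun k i j => by
    have : (fun x => (F k).eval x i j) =
        fun x => ∑ m, ((F k).set m).indicator (fun _ => (F k).coef m i j) x := by
      funext x
      simp only [StepFn.eval, Matrix.sum_apply]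
      refine Finset.sum_congr rfl fun m _ => ?_
      by_cases hx : x ∈ (F k).set m <;> simp [hx]
    rw [this]
    exact memLp_finsetSum _ fun m _ =>
      memLp_indicator_const 2 ((F k).measurableSet m) _ (Or.inr ((F k).finite m))
  refine ⟨hf, MemLp.of_eval_piLp fun i => (Lp.memLp _).ae_eq (hY i).symm, F, hF, ?_⟩
  have e : ∀ k i, (fun ω => ((F k).orthInt (orthMeasure K) ω - Y ω) i) =ᵐ[P]
      ((∑ j, K j ((hE k i j).toLp _) : Lp 𝕜 2 P) : Ω → 𝕜) -
        (∑ j, K j ((hf i j).toLp _) : Lp 𝕜 2 P) := fun k i => by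
    filter_upwards [(F k).orthInt_apply (K := K) i (hE k i), hY i] with ω h1 h2
    rw [PiLp.sub_apply, Pi.sub_apply, h1, h2]
  refine tendsto_eLpNorm_of_eval (fun k i => ?_) fun i => ?_
  · exact (((Lp.memLp _).sub (Lp.memLp _)).ae_eq (e k i).symm).aestronglyMeasurable
  · have : Tendsto (fun k => (∑ j, K j ((hE k i j).toLp _) : Lp 𝕜 2 P)) atTop
        (𝓝 (∑ j, K j ((hf i j).toLp _))) := by
      refine tendsto_finsetSum _ fun j _ => ((K j).continuous.tendsto _).comp ?_
      rw [Lp.tendsto_Lp_iff_tendsto_eLpNorm'']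
      exact hF i j
    rw [Lp.tendsto_Lp_iff_tendsto_eLpNorm'] at this
    exact this.congr fun k => (eLpNorm_congr_ae (e k i)).symm

end OrthogonalMeasure

local notation "L2ℂ" => Lp ℂ 2 (volume : Measure ℝ)

/-! ### Fourier transform, reflection and conjugation on L² -/

section Fourier

/-- The reflection `f ↦ f(-·)` on `L²(ℝ)`. -/
def reflectL : L2ℂ →L[ℂ] L2ℂ :=
  (Lp.compMeasurePreservingₗᵢ ℂ (Neg.neg : ℝ → ℝ)
    (Measure.measurePreserving_neg volume)).toContinuousLinearMap

lemma coeFn_reflectL (f : L2ℂ) : reflectL f =ᵐ[volume] fun x => f (-x) :=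
  Lp.coeFn_compMeasurePreserving f (Measure.measurePreserving_neg volume)

lemma coeFn_ae_neg {f : ℝ → ℂ} {g : ℝ → ℂ} (h : f =ᵐ[volume] g) :
    ∀ᵐ x : ℝ, f (-x) = g (-x) :=
  (Measure.measurePreserving_neg volume).quasiMeasurePreserving.ae h

lemma inner_reflectL (f g : L2ℂ) : inner ℂ (reflectL f) (reflectL g) = inner ℂ f g :=
  LinearIsometry.inner_map_map _ f g

/-- Two continuous maps which agree on Schwartz functions agree on `L²`. -/
lemma eq_of_eq_schwartz {T U : L2ℂ → L2ℂ} (hT : Continuous T) (hU : Continuous U)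
    (h : ∀ f : SchwartzMap ℝ ℂ, T (f.toLp 2) = U (f.toLp 2)) : T = U := by
  funext f
  exact (SchwartzMap.denseRange_toLpCLM (E := ℝ) (F := ℂ) (p := 2) (μ := volume)
    ENNReal.ofNat_ne_top).induction_on (p := fun f => T f = U f) f (isClosed_eq hT hU) h

lemma reflectL_fourierInv (f : L2ℂ) : reflectL (𝓕⁻ f) = 𝓕 f := by
  refine congrFun (eq_of_eq_schwartz (T := fun f => reflectL (𝓕⁻ f)) (U := fun f => 𝓕 f)
    (reflectL.continuous.comp (ContinuousFourierInv.continuous_fourierInv))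
    ContinuousFourier.continuous_fourier fun f => ?_) f
  simp only [SchwartzMap.toLp_fourier_eq, SchwartzMap.toLp_fourierInv_eq]
  ext1
  filter_upwards [coeFn_reflectL ((𝓕⁻ f).toLp 2), coeFn_ae_neg ((𝓕⁻ f).coeFn_toLp 2 volume),
    (𝓕 f).coeFn_toLp 2 volume] with x h1 h2 h3
  rw [h1, h2, h3, SchwartzMap.fourierInv_coe, SchwartzMap.fourier_coe,
    Real.fourierInv_eq_fourier_neg, neg_neg]

lemma fourierInv_reflectL (f : L2ℂ) : 𝓕⁻ (reflectL f) = 𝓕 f := by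
  have h := reflectL_fourierInv (𝓕 f)
  rw [FourierPair.fourierInv_fourier_eq] at h
  rw [h, FourierPair.fourierInv_fourier_eq]

/-- Conjugating the kernel flips the sign of its exponent. The integral formula is only available on
Schwartz functions; density does the rest. -/
lemma conjL_fourier (f : L2ℂ) : conjL volume (𝓕 f) = 𝓕⁻ (conjL volume f) := by
  refine congrFun (eq_of_eq_schwartz (T := fun f => conjL volume (𝓕 f))
    (U := fun f => 𝓕⁻ (conjL volume f))
    ((conjL volume).continuous.comp ContinuousFourier.continuous_fourier)
    (ContinuousFourierInv.continuous_fourierInv.comp (conjL volume).continuous) fun f => ?_) f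
  have e : conjL volume (f.toLp 2) =
      (SchwartzMap.postcompCLM (Complex.conjCLE : ℂ →L[ℝ] ℂ) f).toLp 2 := by
    ext1
    filter_upwards [coeFn_conjL (f.toLp 2), f.coeFn_toLp 2 volume,
      (SchwartzMap.postcompCLM (Complex.conjCLE : ℂ →L[ℝ] ℂ) f).coeFn_toLp 2 volume] with x h1 h2 h3
    rw [h1, h2, h3]
    rfl
  simp only [e, SchwartzMap.toLp_fourier_eq, SchwartzMap.toLp_fourierInv_eq]
  ext1
  filter_upwards [coeFn_conjL ((𝓕 f).toLp 2), (𝓕 f).coeFn_toLp 2 volume,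
    (𝓕⁻ (SchwartzMap.postcompCLM (Complex.conjCLE : ℂ →L[ℝ] ℂ) f)).coeFn_toLp 2 volume]
    with x h1 h2 h3
  rw [h1, h2, h3, SchwartzMap.fourierInv_coe, SchwartzMap.fourier_coe, Real.fourier_eq',
    Real.fourierInv_eq', ← integral_conj]
  refine integral_congr_ae (ae_of_all _ fun y => ?_)
  simp [← Complex.exp_conj, Complex.conj_ofNat]

lemma conjL_fourierInv (f : L2ℂ) : conjL volume (𝓕⁻ f) = 𝓕 (conjL volume f) := by
  have := conjL_fourier (𝓕⁻ f)
  rw [FourierInvPair.fourier_fourierInv_eq] at this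
  rw [this, FourierInvPair.fourier_fourierInv_eq]

/-- The Fourier transform of a Hermitian function is real. -/
lemma conjL_fourier_of_hermitian {f : L2ℂ} (hf : conjL volume f = reflectL f) :
    conjL volume (𝓕 f) = 𝓕 f := by
  rw [conjL_fourier, hf, fourierInv_reflectL]

/-- The inverse Fourier transform of a real function is Hermitian. -/
lemma conjL_fourierInv_of_real {f : L2ℂ} (hf : conjL volume f = f) :
    conjL volume (𝓕⁻ f) = reflectL (𝓕⁻ f) := by
  rw [conjL_fourierInv, hf, reflectL_fourierInv]

end Fourier

/-! ### Unitary dilations -/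

section Dilation

lemma quasiMeasurePreserving_const_mul {c : ℝ} (hc : 0 < c) :
    Measure.QuasiMeasurePreserving (fun x : ℝ => c * x) volume volume := by
  refine ⟨by fun_prop, ?_⟩
  rw [Real.map_volume_mul_left hc.ne']
  exact Measure.smul_absolutelyContinuous

lemma memLp_dilate {f : ℝ → ℂ} (hf : MemLp f 2 volume) {c : ℝ} (hc : 0 < c) :
    MemLp (fun x => (Real.sqrt c : ℂ) * f (c * x)) 2 volume := by
  refine MemLp.const_mul (MemLp.comp_of_map (f := fun x : ℝ => c * x) ?_ (by fun_prop)) _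
  rw [Real.map_volume_mul_left hc.ne']
  exact hf.smul_measure ENNReal.ofReal_ne_top

/-- The unitary dilation `f ↦ √c f(c ·)` on `L²(ℝ)`. -/
def dilateL (c : ℝ) (hc : 0 < c) : L2ℂ →ₗᵢ[ℂ] L2ℂ :=
  LinearMap.isometryOfInner (𝕜 := ℂ)
    { toFun := fun f => (memLp_dilate (Lp.memLp f) hc).toLp _
      map_add' := fun f g => by
        rw [← MemLp.toLp_add]
        refine MemLp.toLp_congr _ _ ?_
        filter_upwards [(quasiMeasurePreserving_const_mul hc).ae (Lp.coeFn_add f g)] with x hx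
        rw [hx, Pi.add_apply, Pi.add_apply, mul_add]
      map_smul' := fun a f => by
        rw [RingHom.id_apply, ← MemLp.toLp_const_smul]
        refine MemLp.toLp_congr _ _ ?_
        filter_upwards [(quasiMeasurePreserving_const_mul hc).ae (Lp.coeFn_smul a f)] with x hx
        simp only [hx, Pi.smul_apply, smul_eq_mul]
        ring }
    fun f g => by
      have e : (fun x => inner ℂ ((memLp_dilate (Lp.memLp f) hc).toLp _ x)
          ((memLp_dilate (Lp.memLp g) hc).toLp _ x)) =ᵐ[volume]
          fun x => (c : ℂ) * (fun y => inner ℂ (f y) (g y)) (c * x) := by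
        filter_upwards [(memLp_dilate (Lp.memLp f) hc).coeFn_toLp,
          (memLp_dilate (Lp.memLp g) hc).coeFn_toLp] with x h1 h2
        have hs : (Real.sqrt c : ℂ) * (Real.sqrt c : ℂ) = c := by
          rw [← Complex.ofReal_mul, Real.mul_self_sqrt hc.le]
        simp only [h1, h2, RCLike.inner_apply, map_mul, Complex.conj_ofReal, ← hs]
        ring
      rw [LinearMap.coe_mk, AddHom.coe_mk, L2.inner_def, L2.inner_def, integral_congr_ae e,
        integral_const_mul, Measure.integral_comp_mul_left (fun y => inner ℂ (f y) (g y)),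
        abs_of_pos (inv_pos.2 hc)]
      simp [hc.ne']

lemma coeFn_dilateL {c : ℝ} (hc : 0 < c) (f : L2ℂ) :
    dilateL c hc f =ᵐ[volume] fun x => (Real.sqrt c : ℂ) * f (c * x) :=
  (memLp_dilate (Lp.memLp f) hc).coeFn_toLp

lemma conjL_dilateL {c : ℝ} (hc : 0 < c) (f : L2ℂ) :
    conjL volume (dilateL c hc f) = dilateL c hc (conjL volume f) := by
  ext1
  filter_upwards [coeFn_conjL (dilateL c hc f), coeFn_dilateL hc f,
    coeFn_dilateL hc (conjL volume f),
    (quasiMeasurePreserving_const_mul hc).ae (coeFn_conjL f)] with x h1 h2 h3 h4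
  rw [h1, h2, h3, h4, map_mul, Complex.conj_ofReal]

lemma dilateL_dilateL_inv {c : ℝ} (hc : 0 < c) (f : L2ℂ) :
    dilateL c hc (dilateL c⁻¹ (inv_pos.2 hc) f) = f := by
  ext1
  filter_upwards [coeFn_dilateL hc (dilateL c⁻¹ (inv_pos.2 hc) f),
    (quasiMeasurePreserving_const_mul hc).ae (coeFn_dilateL (inv_pos.2 hc) f)] with x h1 h2
  rw [h1, h2, ← mul_assoc, ← Complex.ofReal_mul, ← Real.sqrt_mul hc.le, mul_inv_cancel₀ hc.ne',
    inv_mul_cancel_left₀ hc.ne']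
  simp

end Dilation

/-! ### The unitary normalisation of the Fourier transform -/

section UnitaryFourier

/-- The unitary transform `f ↦ (2π)^{-1/2} ∫ e^{-isx} f(x) dx` on `L²(ℝ)`. -/
def unitaryFourier : L2ℂ →ₗᵢ[ℂ] L2ℂ :=
  (dilateL (2 * Real.pi)⁻¹ (inv_pos.2 Real.two_pi_pos)).comp
    (Lp.fourierTransformₗᵢ ℝ ℂ).toLinearIsometry

/-- The inverse of `unitaryFourier`. -/
def unitaryFourierInv : L2ℂ →ₗᵢ[ℂ] L2ℂ :=
  (Lp.fourierTransformₗᵢ ℝ ℂ).symm.toLinearIsometry.comp (dilateL (2 * Real.pi) Real.two_pi_pos)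

lemma unitaryFourier_apply (f : L2ℂ) :
    unitaryFourier f = dilateL (2 * Real.pi)⁻¹ (inv_pos.2 Real.two_pi_pos) (𝓕 f) := rfl

lemma unitaryFourierInv_apply (f : L2ℂ) :
    unitaryFourierInv f = 𝓕⁻ (dilateL (2 * Real.pi) Real.two_pi_pos f) := rfl

lemma unitaryFourierInv_unitaryFourier (f : L2ℂ) :
    unitaryFourierInv (unitaryFourier f) = f := by
  rw [unitaryFourierInv_apply, unitaryFourier_apply, dilateL_dilateL_inv,
    FourierPair.fourierInv_fourier_eq]

lemma conjL_unitaryFourier_of_hermitian {f : L2ℂ} (hf : conjL volume f = reflectL f) :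
    conjL volume (unitaryFourier f) = unitaryFourier f := by
  rw [unitaryFourier_apply, conjL_dilateL, conjL_fourier_of_hermitian hf]

lemma conjL_unitaryFourierInv_of_real {f : L2ℂ} (hf : conjL volume f = f) :
    conjL volume (unitaryFourierInv f) = reflectL (unitaryFourierInv f) := by
  rw [unitaryFourierInv_apply]
  exact conjL_fourierInv_of_real (by rw [conjL_dilateL, hf])

/-- Evaluating at s/(2π) with the factor (2π)^(-1/2) is precisely the unitary dilation with c =
(2π)⁻¹. -/
lemma invFourierL2_ae_eq {f : ℝ → ℂ} (hf : MemLp f 2 (volume : Measure ℝ)) :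
    invFourierL2 f =ᵐ[volume] unitaryFourier (hf.toLp f) := by
  rw [unitaryFourier_apply]
  filter_upwards [coeFn_dilateL (inv_pos.2 Real.two_pi_pos) (𝓕 (hf.toLp f))] with s hs
  rw [hs, invFourierL2, dif_pos hf, Real.sqrt_inv, div_eq_inv_mul]

end UnitaryFourier

/-! ### Symmetry of the kernels -/

section Kernels

variable {p : ℕ} (H : Matrix (Fin p) (Fin p) ℝ) (A : Matrix (Fin p) (Fin p) ℂ) (t : ℝ)

/-- Reflection exchanges the two one-sided powers, while conjugation exchanges A and Ā; the scalar
quotient is itself Hermitian. -/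
lemma harmKernel_neg (x : ℝ) (i j : Fin p) :
    harmKernel H A t (-x) i j = (starRingEnd ℂ) (harmKernel H A t x i j) := by
  have h1 : (starRingEnd ℂ) ((Complex.exp (Complex.I * t * x) - 1) / (Complex.I * x)) =
      (Complex.exp (Complex.I * t * (-x : ℝ)) - 1) / (Complex.I * (-x : ℝ)) := by
    rw [map_div₀, map_sub, ← Complex.exp_conj]
    simp
  simp only [harmKernel, Matrix.smul_apply, Matrix.add_apply, Matrix.mul_apply, Matrix.map_apply,
    smul_eq_mul, map_mul, map_add, map_sum, Complex.conj_ofReal, Complex.conj_conj, h1, neg_neg]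
  rw [add_comm]

variable {H A t} {i j : Fin p}

lemma conjL_harmKernel (hf : MemLp (fun x => harmKernel H A t x i j) 2 (volume : Measure ℝ)) :
    conjL volume (hf.toLp _) = reflectL (hf.toLp _) := by
  ext1
  filter_upwards [coeFn_conjL (hf.toLp _), coeFn_reflectL (hf.toLp _), hf.coeFn_toLp,
    coeFn_ae_neg hf.coeFn_toLp] with x h1 h2 h3 h4
  rw [h1, h2, h3, h4, harmKernel_neg]

/-- The moving average kernel is the unitary transform of the harmonizable one. -/
lemma ofReal_maKernel_ae_eq
    (hf : MemLp (fun x => harmKernel H A t x i j) 2 (volume : Measure ℝ)) :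
    (fun s => (maKernel H A t s i j : ℂ)) =ᵐ[volume] unitaryFourier (hf.toLp _) := by
  filter_upwards [invFourierL2_ae_eq hf, ofReal_re_of_conjL_eq
    (conjL_unitaryFourier_of_hermitian (conjL_harmKernel hf))] with s h1 h2
  rw [maKernel, Matrix.of_apply, h1, h2]

lemma memLp_maKernel (hf : MemLp (fun x => harmKernel H A t x i j) 2 (volume : Measure ℝ)) :
    MemLp (fun s => maKernel H A t s i j) 2 (volume : Measure ℝ) := by
  have := ((Lp.memLp _).ae_eq (ofReal_maKernel_ae_eq hf).symm).re
  simpa using this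

end Kernels

/-! ### Lévy measures with finite second moment -/

section Levy

variable {𝕜 : Type*} [RCLike 𝕜] {p : ℕ} {μ : Measure (EuclideanSpace 𝕜 (Fin p))}

/-- The measure ‖z‖² μ(dz) is finite, and since μ does not charge the origin, μ has density ‖z‖⁻²
with respect to it. This makes Fubini available on dx ⊗ μ. -/
lemma IsLevyL2.sFinite (h : IsLevyL2 μ) : SFinite μ := by
  set w : EuclideanSpace 𝕜 (Fin p) → ℝ≥0∞ := fun z => ‖z‖ₑ ^ 2
  have hw : Measurable w := by fun_prop
  have h0 : ∀ᵐ z ∂μ, w z ≠ 0 := by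
    have : ∀ᵐ z ∂μ, z ∉ ({0} : Set _) := measure_eq_zero_iff_ae_notMem.1 h.zero
    filter_upwards [this] with z hz
    simpa [w] using hz
  have : IsFiniteMeasure (μ.withDensity w) := isFiniteMeasure_withDensity h.secondMoment.ne
  rw [← withDensity_inv_same₀ hw.aemeasurable h0 (ae_of_all _ fun z => by simp [w])]
  infer_instance

lemma IsLevyL2.memLp_id (h : IsLevyL2 μ) : MemLp (fun z => z) 2 μ := by
  refine ⟨measurable_id.aestronglyMeasurable, ?_⟩
  rw [eLpNorm_lt_top_iff_lintegral_rpow_enorm_lt_top (by norm_num) (by norm_num)]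
  simpa using h.secondMoment

lemma IsLevyL2.memLp_clm_apply (h : IsLevyL2 μ) (e : 𝕜 →L[ℝ] ℂ) (i : Fin p) :
    MemLp (fun z => e (z i)) 2 μ :=
  OfLm.memLp_clm_apply h.memLp_id e i

/-- The function `z ↦ e (zᵢ)` in `L²(μ)`. -/
def IsLevyL2.coordL (h : IsLevyL2 μ) (e : 𝕜 →L[ℝ] ℂ) (i : Fin p) : Lp ℂ 2 μ :=
  (h.memLp_clm_apply e i).toLp _

lemma IsLevyL2.coeFn_coordL (h : IsLevyL2 μ) (e : 𝕜 →L[ℝ] ℂ) (i : Fin p) :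
    h.coordL e i =ᵐ[μ] fun z => e (z i) :=
  (h.memLp_clm_apply e i).coeFn_toLp

lemma IsLevyL2.inner_coordL (h : IsLevyL2 μ) (e e' : 𝕜 →L[ℝ] ℂ) (i j : Fin p) :
    inner ℂ (h.coordL e i) (h.coordL e' j) = ∫ z, (starRingEnd ℂ) (e (z i)) * e' (z j) ∂μ := by
  rw [L2.inner_def]
  refine integral_congr_ae ?_
  filter_upwards [h.coeFn_coordL e i, h.coeFn_coordL e' j] with z h1 h2
  rw [h1, h2, RCLike.inner_apply, mul_comm]

end Levy

/-! ### Tensor products f(x) h(z) in L² of a product measure -/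

section Tensor

variable {α β : Type*} [MeasurableSpace α] [MeasurableSpace β] {κ : Measure α} {μ : Measure β}

lemma memLp_tensor (f : Lp ℂ 2 κ) (h : Lp ℂ 2 μ) :
    MemLp (fun w : α × β => f w.1 * h w.2) 2 (κ.prod μ) := by
  have hm : AEStronglyMeasurable (fun w : α × β => f w.1 * h w.2) (κ.prod μ) :=
    (Lp.aestronglyMeasurable f).comp_fst.mul (Lp.aestronglyMeasurable h).comp_snd
  rw [memLp_two_iff_integrable_sq_norm hm]
  have h1 := (memLp_two_iff_integrable_sq_norm (Lp.aestronglyMeasurable f)).1 (Lp.memLp f)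
  have h2 := (memLp_two_iff_integrable_sq_norm (Lp.aestronglyMeasurable h)).1 (Lp.memLp h)
  simpa [mul_pow] using h1.mul_prod h2

variable [SFinite κ] [SFinite μ]

lemma inner_tensor (f g : Lp ℂ 2 κ) (h k : Lp ℂ 2 μ) :
    inner ℂ ((memLp_tensor f h).toLp _) ((memLp_tensor g k).toLp _) =
      inner ℂ f g * inner ℂ h k := by
  rw [L2.inner_def, L2.inner_def, L2.inner_def, ← integral_prod_mul]
  refine integral_congr_ae ?_
  filter_upwards [(memLp_tensor f h).coeFn_toLp, (memLp_tensor g k).coeFn_toLp] with w h1 h2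
  simp only [h1, h2, RCLike.inner_apply, map_mul]
  ring

/-- The operator `f ↦ f ⊗ h` from `L²(κ)` to `L²(κ ⊗ μ)`. -/
def tensorL (κ : Measure α) [SFinite κ] (h : Lp ℂ 2 μ) : Lp ℂ 2 κ →L[ℂ] Lp ℂ 2 (κ.prod μ) :=
  LinearMap.mkContinuous
    { toFun := fun f => (memLp_tensor f h).toLp _
      map_add' := fun f g => by
        rw [← MemLp.toLp_add]
        refine MemLp.toLp_congr _ _ ?_
        filter_upwards [Measure.quasiMeasurePreserving_fst.ae (Lp.coeFn_add f g)] with w hw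
        rw [hw, Pi.add_apply, Pi.add_apply, add_mul]
      map_smul' := fun a f => by
        rw [RingHom.id_apply, ← MemLp.toLp_const_smul]
        refine MemLp.toLp_congr _ _ ?_
        filter_upwards [Measure.quasiMeasurePreserving_fst.ae (Lp.coeFn_smul a f)] with w hw
        simp only [hw, Pi.smul_apply, smul_eq_mul, mul_assoc] }
    ‖h‖ fun f => by
      refine le_of_sq_le_sq ?_ (by positivity)
      have := inner_tensor f f h h
      rw [inner_self_eq_norm_sq_to_K, inner_self_eq_norm_sq_to_K,
        inner_self_eq_norm_sq_to_K] at this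
      rw [mul_pow, mul_comm]
      exact le_of_eq (by exact_mod_cast this)

lemma coeFn_tensorL (h : Lp ℂ 2 μ) (f : Lp ℂ 2 κ) :
    tensorL κ h f =ᵐ[κ.prod μ] fun w => f w.1 * h w.2 :=
  (memLp_tensor f h).coeFn_toLp

lemma inner_tensorL (f g : Lp ℂ 2 κ) (h k : Lp ℂ 2 μ) :
    inner ℂ (tensorL κ h f) (tensorL κ k g) = inner ℂ f g * inner ℂ h k :=
  inner_tensor f g h k

lemma conjL_tensorL (h : Lp ℂ 2 μ) (f : Lp ℂ 2 κ) :
    conjL (κ.prod μ) (tensorL κ h f) = tensorL κ (conjL μ h) (conjL κ f) := by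
  ext1
  filter_upwards [coeFn_conjL (tensorL κ h f), coeFn_tensorL h f,
    coeFn_tensorL (conjL μ h) (conjL κ f),
    Measure.quasiMeasurePreserving_fst.ae (coeFn_conjL f),
    Measure.quasiMeasurePreserving_snd.ae (coeFn_conjL h)] with w h1 h2 h3 h4 h5
  rw [h1, h2, h3, h4, h5, map_mul]

end Tensor

/-! ### Passing between real and complex L² -/

section RealPart

variable {α : Type*} [MeasurableSpace α] {μ : Measure α}

/-- The inclusion of real into complex `L²` functions. -/
def ofRealL (μ : Measure α) : Lp ℝ 2 μ →L[ℝ] Lp ℂ 2 μ := Complex.ofRealCLM.compLpL 2 μ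

/-- The real part of complex `L²` functions. -/
def reL (μ : Measure α) : Lp ℂ 2 μ →L[ℝ] Lp ℝ 2 μ := Complex.reCLM.compLpL 2 μ

lemma coeFn_ofRealL (f : Lp ℝ 2 μ) : ofRealL μ f =ᵐ[μ] fun x => (f x : ℂ) :=
  Complex.ofRealCLM.coeFn_compLpL f

lemma coeFn_reL (f : Lp ℂ 2 μ) : reL μ f =ᵐ[μ] fun x => (f x).re :=
  Complex.reCLM.coeFn_compLpL f

lemma inner_ofRealL (f g : Lp ℝ 2 μ) :
    inner ℂ (ofRealL μ f) (ofRealL μ g) = ((inner ℝ f g : ℝ) : ℂ) := by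
  rw [L2.inner_def, L2.inner_def, ← integral_complex_ofReal]
  refine integral_congr_ae ?_
  filter_upwards [coeFn_ofRealL f, coeFn_ofRealL g] with x h1 h2
  simp [h1, h2]

lemma ofRealL_reL {f : Lp ℂ 2 μ} (hf : conjL μ f = f) : ofRealL μ (reL μ f) = f := by
  ext1
  filter_upwards [coeFn_ofRealL (reL μ f), coeFn_reL f, ofReal_re_of_conjL_eq hf] with x h1 h2 h3
  rw [h1, h2, h3]

lemma conjL_ofRealL (f : Lp ℝ 2 μ) : conjL μ (ofRealL μ f) = ofRealL μ f := by
  ext1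
  filter_upwards [coeFn_conjL (ofRealL μ f), coeFn_ofRealL f] with x h1 h2
  rw [h1, h2, Complex.conj_ofReal]

lemma inner_reL {f g : Lp ℂ 2 μ} (hf : conjL μ f = f) (hg : conjL μ g = g) :
    ((inner ℝ (reL μ f) (reL μ g) : ℝ) : ℂ) = inner ℂ f g := by
  rw [← inner_ofRealL, ofRealL_reL hf, ofRealL_reL hg]

end RealPart

/-! ### Part (i): the operators for the moving average -/

section MovingAverage

variable {p : ℕ} {Ω : Type*} [MeasurableSpace Ω] {P : Measure Ω} [IsProbabilityMeasure P]
  {μ : Measure (EuclideanSpace ℝ (Fin p))} [SFinite μ]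
  {N : Ω → Measure (ℝ × EuclideanSpace ℝ (Fin p))}

/-- The operators `f ↦ ∫ (U f)(s) zᵢ Ñ(ds, dz)`, with `U` the unitary Fourier transform. -/
def maOperator (h : IsPoissonRandomMeasure N ((volume : Measure ℝ).prod μ) P) (hμ : IsLevyL2 μ)
    (i : Fin p) : Lp ℂ 2 (volume : Measure ℝ) →L[ℂ] Lp ℂ 2 P :=
  h.integral ∘L tensorL volume (hμ.coordL Complex.ofRealCLM i) ∘L
    unitaryFourier.toContinuousLinearMap

variable (h : IsPoissonRandomMeasure N ((volume : Measure ℝ).prod μ) P) (hμ : IsLevyL2 μ)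

lemma maOperator_apply (i : Fin p) (f : Lp ℂ 2 (volume : Measure ℝ)) :
    maOperator h hμ i f = h.integral (tensorL volume (hμ.coordL Complex.ofRealCLM i)
      (unitaryFourier f)) := rfl

lemma inner_maOperator (hI : UnitSecondMoment μ) (i j : Fin p)
    (f g : Lp ℂ 2 (volume : Measure ℝ)) :
    inner ℂ (maOperator h hμ i f) (maOperator h hμ j g) = if i = j then inner ℂ f g else 0 := by
  have hij := congrFun (congrFun hI i) j
  rw [Matrix.of_apply, Matrix.one_apply] at hij
  have hc : inner ℂ (hμ.coordL Complex.ofRealCLM i) (hμ.coordL Complex.ofRealCLM j) =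
      if i = j then (1 : ℂ) else 0 := by
    rw [hμ.inner_coordL]
    simp only [Complex.ofRealCLM_apply, Complex.conj_ofReal, ← Complex.ofReal_mul]
    rw [integral_complex_ofReal, hij]
    split_ifs <;> simp
  rw [maOperator_apply, maOperator_apply, h.inner_integral, inner_tensorL, hc,
    LinearIsometry.inner_map_map]
  split_ifs <;> simp

/-- Row i of g_t(s) z is Σ_j (U g̃_ij)(s) z_j, a sum of tensors to which the scalar Poisson isometry
applies. -/
lemma maOperator_harmKernel {H : Matrix (Fin p) (Fin p) ℝ} {A : Matrix (Fin p) (Fin p) ℂ} {t : ℝ}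
    (hL : ∀ i j, MemLp (fun x => harmKernel H A t x i j) 2 (volume : Measure ℝ))
    {Y : Ω → EuclideanSpace ℝ (Fin p)}
    (hY : IsPoissonIntegral N μ P (fun w => matVec (maKernel H A t w.1) w.2) Y) (i : Fin p) :
    (fun ω => toC (Y ω) i) =ᵐ[P] (∑ j, maOperator h hμ j ((hL i j).toLp _) : Lp ℂ 2 P) := by
  have e : (memLp_clm_apply hY.1 Complex.ofRealCLM i).toLp _ =
      ∑ j, tensorL volume (hμ.coordL Complex.ofRealCLM j) (unitaryFourier ((hL i j).toLp _)) := by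
    ext1
    filter_upwards [(memLp_clm_apply hY.1 Complex.ofRealCLM i).coeFn_toLp,
      Lp.coeFn_finsetSum Finset.univ fun j =>
        tensorL volume (hμ.coordL Complex.ofRealCLM j) (unitaryFourier ((hL i j).toLp _)),
      ae_all_iff.2 fun j =>
        coeFn_tensorL (hμ.coordL Complex.ofRealCLM j) (unitaryFourier ((hL i j).toLp _)),
      ae_all_iff.2 fun j =>
        (Measure.quasiMeasurePreserving_fst (μ := (volume : Measure ℝ)) (ν := μ)).ae
          (ofReal_maKernel_ae_eq (hL i j)),
      ae_all_iff.2 fun j =>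
        (Measure.quasiMeasurePreserving_snd (μ := (volume : Measure ℝ)) (ν := μ)).ae
          (hμ.coeFn_coordL Complex.ofRealCLM j)] with w h1 h2 h3 h4 h5
    rw [h1, h2, Finset.sum_apply]
    simp only [h3, h5, ← h4, matVec, Matrix.mulVec, dotProduct, Complex.ofRealCLM_apply]
    push_cast
    rfl
  have := hY.integral_toLp_eq h Complex.ofRealCLM i
  rw [e, map_sum] at this
  simp only [maOperator_apply]
  rw [this]
  exact (memLp_clm_apply hY.2.1 Complex.ofRealCLM i).coeFn_toLp.symm

end MovingAverage

/-! ### Part (ii): the operators for the harmonizable motion -/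

section Harmonizable

variable {p : ℕ} {Ω : Type*} [MeasurableSpace Ω] {P : Measure Ω} [IsProbabilityMeasure P]
  {μ : Measure (EuclideanSpace ℂ (Fin p))}
  {N : Ω → Measure (ℝ × EuclideanSpace ℂ (Fin p))}

local notation "idC" => ContinuousLinearMap.id ℝ ℂ
local notation "conjC" => (Complex.conjCLE : ℂ →L[ℝ] ℂ)

lemma conjL_coordL (hμ : IsLevyL2 μ) (i : Fin p) :
    conjL μ (hμ.coordL idC i) = hμ.coordL conjC i := by
  ext1
  filter_upwards [coeFn_conjL (hμ.coordL idC i), hμ.coeFn_coordL idC i,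
    hμ.coeFn_coordL conjC i] with z h1 h2 h3
  rw [h1, h2, h3]
  rfl

/-- The second moments `∫ zᵢ zⱼ dμ` of a rotation invariant measure vanish. -/
lemma integral_mul_eq_zero_of_rotationInvariant (hr : RotationInvariant μ) (i j : Fin p) :
    ∫ z, z i * z j ∂μ = 0 := by
  -- Only the quarter turn is needed: it multiplies z_i z_j by i² = -1, so the integral equals its
  -- own negative.
  have hm := hr (Real.pi / 2) ⟨by linarith [Real.pi_pos], by linarith [Real.pi_pos]⟩
  have hI : Complex.exp (Complex.I * (Real.pi / 2 : ℝ)) = Complex.I := by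
    rw [mul_comm]
    push_cast
    exact Complex.exp_pi_div_two_mul_I
  rw [hI] at hm
  have h1 : ∫ z, z i * z j ∂μ = ∫ z, -(z i * z j) ∂μ := by
    conv_lhs => rw [← hm]
    rw [integral_map (by fun_prop) (by fun_prop)]
    refine integral_congr_ae (ae_of_all _ fun z => ?_)
    simp only [PiLp.smul_apply, smul_eq_mul]
    linear_combination (z i * z j) * Complex.I_mul_I
  rw [integral_neg] at h1
  exact self_eq_neg.1 h1

/-- The two integrands add up to 2(Re z_i Re z_j + Im z_i Im z_j), and each real moment matrix is
I/4, so the total is 2(1/4 + 1/4) δ_ij. -/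
lemma inner_coordL_add (hμ : IsLevyL2 μ) (hI : UnitSecondMomentC μ) (i j : Fin p) :
    inner ℂ (hμ.coordL idC i) (hμ.coordL idC j) +
      inner ℂ (hμ.coordL conjC i) (hμ.coordL conjC j) = if i = j then (1 : ℂ) else 0 := by
  have hre := congrFun (congrFun hI.1 i) j
  have him := congrFun (congrFun hI.2 i) j
  simp only [Matrix.smul_apply, Matrix.of_apply, Matrix.one_apply, smul_eq_mul] at hre him
  have hco : ∀ i, MemLp (fun z : EuclideanSpace ℂ (Fin p) => z i) 2 μ := fun i =>
    hμ.memLp_clm_apply idC i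
  have hr : Integrable (fun z : EuclideanSpace ℂ (Fin p) => (z i).re * (z j).re) μ :=
    (hco i).re.integrable_mul (hco j).re
  have hm : Integrable (fun z : EuclideanSpace ℂ (Fin p) => (z i).im * (z j).im) μ :=
    (hco i).im.integrable_mul (hco j).im
  have h1 : Integrable (fun z : EuclideanSpace ℂ (Fin p) => (starRingEnd ℂ) (z i) * z j) μ :=
    (hμ.memLp_clm_apply conjC i).integrable_mul (hco j)
  have h2 : Integrable (fun z : EuclideanSpace ℂ (Fin p) => z i * (starRingEnd ℂ) (z j)) μ :=
    (hco i).integrable_mul (hμ.memLp_clm_apply conjC j)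
  rw [hμ.inner_coordL, hμ.inner_coordL]
  have e : (∫ z, (starRingEnd ℂ) (idC (z i)) * idC (z j) ∂μ) +
      ∫ z, (starRingEnd ℂ) (conjC (z i)) * conjC (z j) ∂μ =
      ∫ z, ((2 * ((z i).re * (z j).re) + 2 * ((z i).im * (z j).im) : ℝ) : ℂ) ∂μ := by
    have : ∀ z : EuclideanSpace ℂ (Fin p), (starRingEnd ℂ) (conjC (z i)) * conjC (z j) =
      z i * (starRingEnd ℂ) (z j) := fun z => by simp
    simp only [this]
    refine (integral_add h1 h2).symm.trans (integral_congr_ae (ae_of_all _ fun z => ?_))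
    apply Complex.ext
    · simp; ring
    · simp; ring
  rw [e, integral_complex_ofReal, integral_add (hr.const_mul 2) (hm.const_mul 2),
    integral_const_mul, integral_const_mul]
  split_ifs at hre him ⊢
  · rw [← Complex.ofReal_one]; congr 1; linarith
  · rw [← Complex.ofReal_zero]; congr 1; linarith

variable [SFinite μ]

/-- The operators `f ↦ ∫ (f(x) zᵢ + f(-x) z̄ᵢ) Ñ(dx, dz)`. -/
def harmOperator (h : IsPoissonRandomMeasure N ((volume : Measure ℝ).prod μ) P) (hμ : IsLevyL2 μ)
    (i : Fin p) : Lp ℂ 2 (volume : Measure ℝ) →L[ℂ] Lp ℂ 2 P :=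
  h.integral ∘L (tensorL volume (hμ.coordL idC i) + tensorL volume (hμ.coordL conjC i) ∘L reflectL)

variable (h : IsPoissonRandomMeasure N ((volume : Measure ℝ).prod μ) P) (hμ : IsLevyL2 μ)

lemma harmOperator_apply (i : Fin p) (f : Lp ℂ 2 (volume : Measure ℝ)) :
    harmOperator h hμ i f = h.integral (tensorL volume (hμ.coordL idC i) f +
      tensorL volume (hμ.coordL conjC i) (reflectL f)) := rfl

/-- Of the four products, the two mixed ones carry the pseudo-covariance of μ and vanish; reflection
being unitary, the other two share the factor ⟨f, g⟩. -/
lemma inner_harmOperator (hI : UnitSecondMomentC μ) (hr : RotationInvariant μ) (i j : Fin p)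
    (f g : Lp ℂ 2 (volume : Measure ℝ)) :
    inner ℂ (harmOperator h hμ i f) (harmOperator h hμ j g) =
      if i = j then inner ℂ f g else 0 := by
  have h1 : inner ℂ (hμ.coordL conjC i) (hμ.coordL idC j) = 0 := by
    rw [hμ.inner_coordL]
    simpa using integral_mul_eq_zero_of_rotationInvariant hr i j
  have h2 : inner ℂ (hμ.coordL idC i) (hμ.coordL conjC j) = 0 := by
    rw [← inner_conj_symm, hμ.inner_coordL]
    simpa using integral_mul_eq_zero_of_rotationInvariant hr j i
  have h3 := inner_coordL_add hμ hI i j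
  rw [harmOperator_apply, harmOperator_apply, h.inner_integral, inner_add_left, inner_add_right,
    inner_add_right, inner_tensorL, inner_tensorL, inner_tensorL, inner_tensorL, h1, h2,
    inner_reflectL, mul_zero, mul_zero, add_zero, zero_add, ← mul_add, h3]
  split_ifs <;> simp

/-- Harmonizable integrals of Hermitian functions are real. -/
lemma conjL_harmOperator (i : Fin p) {f : Lp ℂ 2 (volume : Measure ℝ)}
    (hf : conjL volume f = reflectL f) :
    conjL P (harmOperator h hμ i f) = harmOperator h hμ i f := by
  have hc : conjL μ (hμ.coordL conjC i) = hμ.coordL idC i := by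
    rw [← conjL_coordL, conjL_conjL]
  -- Conjugation exchanges the two tensor terms; reading the Hermitian relation backwards shows that
  -- the conjugate of the reflected f is f.
  rw [harmOperator_apply, h.conjL_integral, map_add, conjL_tensorL, conjL_tensorL, conjL_coordL,
    hc, hf, ← hf, conjL_conjL, hf, add_comm]

/-- The real operators `f ↦ ∫ ((V f)(x) zᵢ + (V f)(-x) z̄ᵢ) Ñ(dx, dz)`, with `V` the inverse
unitary Fourier transform. -/
def realHarmOperator (h : IsPoissonRandomMeasure N ((volume : Measure ℝ).prod μ) P)
    (hμ : IsLevyL2 μ) (i : Fin p) : Lp ℝ 2 (volume : Measure ℝ) →L[ℝ] Lp ℝ 2 P :=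
  reL P ∘L (harmOperator h hμ i ∘L unitaryFourierInv.toContinuousLinearMap).restrictScalars ℝ ∘L
    ofRealL volume

lemma realHarmOperator_apply (i : Fin p) (f : Lp ℝ 2 (volume : Measure ℝ)) :
    realHarmOperator h hμ i f =
      reL P (harmOperator h hμ i (unitaryFourierInv (ofRealL volume f))) := rfl

/-- The harmonizable integral of U⁻¹ f is already real when f is, so taking real parts loses nothing
and the complex isometry descends. -/
lemma inner_realHarmOperator (hI : UnitSecondMomentC μ) (hr : RotationInvariant μ) (i j : Fin p)
    (f g : Lp ℝ 2 (volume : Measure ℝ)) :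
    inner ℝ (realHarmOperator h hμ i f) (realHarmOperator h hμ j g) =
      if i = j then inner ℝ f g else 0 := by
  have hc := fun (i : Fin p) (f : Lp ℝ 2 (volume : Measure ℝ)) =>
    conjL_harmOperator h hμ i (conjL_unitaryFourierInv_of_real (conjL_ofRealL f))
  apply Complex.ofReal_injective
  rw [realHarmOperator_apply, realHarmOperator_apply, inner_reL (hc i f) (hc j g),
    inner_harmOperator h hμ hI hr, LinearIsometry.inner_map_map, inner_ofRealL]
  split_ifs <;> simp

lemma integral_realHarmOperator (i : Fin p) (f : Lp ℝ 2 (volume : Measure ℝ)) :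
    ∫ ω, realHarmOperator h hμ i f ω ∂P = 0 := by
  rw [realHarmOperator_apply, integral_congr_ae (coeFn_reL _)]
  set g := harmOperator h hμ i (unitaryFourierInv (ofRealL volume f))
  have hg : Integrable g P := (Lp.memLp g).integrable (by norm_num)
  have := integral_re hg
  rw [show ∫ ω, g ω ∂P = 0 from h.integral_integral_eq_zero _] at this
  simpa using this

/-- U⁻¹ carries the moving average kernel back to the harmonizable one, whose integral is the given
real process. -/
lemma realHarmOperator_maKernel {H : Matrix (Fin p) (Fin p) ℝ} {A : Matrix (Fin p) (Fin p) ℂ}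
    {t : ℝ} (hL : ∀ i j, MemLp (fun x => harmKernel H A t x i j) 2 (volume : Measure ℝ))
    {X : Ω → EuclideanSpace ℝ (Fin p)}
    (hX : IsPoissonIntegral N μ P (fun w => matVec (harmKernel H A t w.1) w.2 +
      matVec (harmKernel H A t (-w.1)) (conjVec w.2)) (fun ω => toC (X ω))) (i : Fin p) :
    (fun ω => X ω i) =ᵐ[P]
      (∑ j, realHarmOperator h hμ j ((memLp_maKernel (hL i j)).toLp _) : Lp ℝ 2 P) := by
  have hU : ∀ j, unitaryFourierInv (ofRealL volume ((memLp_maKernel (hL i j)).toLp _)) =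
      (hL i j).toLp _ := fun j => by
    rw [← unitaryFourierInv_unitaryFourier ((hL i j).toLp _)]
    congr 1
    ext1
    filter_upwards [coeFn_ofRealL ((memLp_maKernel (hL i j)).toLp _),
      (memLp_maKernel (hL i j)).coeFn_toLp, ofReal_maKernel_ae_eq (hL i j)] with s h1 h2 h3
    rw [h1, h2, h3]
  have e : (memLp_clm_apply hX.1 idC i).toLp _ =
      ∑ j, (tensorL volume (hμ.coordL idC j) ((hL i j).toLp _) +
        tensorL volume (hμ.coordL conjC j) (reflectL ((hL i j).toLp _))) := by
    have hq1 := Measure.quasiMeasurePreserving_fst (μ := (volume : Measure ℝ)) (ν := μ)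
    have hq2 := Measure.quasiMeasurePreserving_snd (μ := (volume : Measure ℝ)) (ν := μ)
    ext1
    filter_upwards [(memLp_clm_apply hX.1 idC i).coeFn_toLp,
      Lp.coeFn_finsetSum Finset.univ fun j => tensorL volume (hμ.coordL idC j) ((hL i j).toLp _) +
        tensorL volume (hμ.coordL conjC j) (reflectL ((hL i j).toLp _)),
      ae_all_iff.2 fun j => Lp.coeFn_add (tensorL volume (hμ.coordL idC j) ((hL i j).toLp _))
        (tensorL volume (hμ.coordL conjC j) (reflectL ((hL i j).toLp _))),
      ae_all_iff.2 fun j => coeFn_tensorL (hμ.coordL idC j) ((hL i j).toLp _),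
      ae_all_iff.2 fun j => coeFn_tensorL (hμ.coordL conjC j) (reflectL ((hL i j).toLp _)),
      ae_all_iff.2 fun j => hq1.ae (hL i j).coeFn_toLp,
      ae_all_iff.2 fun j => hq1.ae (coeFn_reflectL ((hL i j).toLp _)),
      ae_all_iff.2 fun j => hq1.ae (coeFn_ae_neg (hL i j).coeFn_toLp),
      ae_all_iff.2 fun j => hq2.ae (hμ.coeFn_coordL idC j),
      ae_all_iff.2 fun j => hq2.ae (hμ.coeFn_coordL conjC j)]
      with w h1 h2 h3 h4 h5 h6 h7 h8 h9 h10
    rw [h1, h2, Finset.sum_apply]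
    simp only [h3, Pi.add_apply, h4, h5, h6, h7, h8, h9, h10, matVec, Matrix.mulVec, dotProduct,
      Finset.sum_add_distrib, PiLp.add_apply, conjVec]
    rfl
  have := hX.integral_toLp_eq h idC i
  rw [e, map_sum] at this
  simp only [realHarmOperator_apply, hU, harmOperator_apply]
  rw [← map_sum, this]
  filter_upwards [coeFn_reL ((memLp_clm_apply hX.2.1 idC i).toLp _),
    (memLp_clm_apply hX.2.1 idC i).coeFn_toLp] with ω h1 h2
  rw [h1, h2]
  rfl

end Harmonizable

/-! ### Growth of matrix exponentials -/

section MatrixExponential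

attribute [local instance] Matrix.linftyOpNormedRing Matrix.linftyOpNormedAlgebra

variable {p : ℕ}

lemma exp_mulVec_of_eigenvector (M : Matrix (Fin p) (Fin p) ℂ) {z : ℂ} {v : Fin p → ℂ}
    (hv : M *ᵥ v = z • v) : NormedSpace.exp M *ᵥ v = Complex.exp z • v := by
  have hp : ∀ n : ℕ, M ^ n *ᵥ v = z ^ n • v := fun n => by
    induction n with
    | zero => simp
    | succ n ih => rw [pow_succ, ← Matrix.mulVec_mulVec, hv, Matrix.mulVec_smul, ih, smul_smul,
        pow_succ, mul_comm]
  have hc : Continuous fun X : Matrix (Fin p) (Fin p) ℂ => X *ᵥ v := by fun_prop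
  have h1 : HasSum (fun n : ℕ => ((n.factorial : ℂ)⁻¹ • M ^ n) *ᵥ v) (NormedSpace.exp M *ᵥ v) :=
    (NormedSpace.exp_series_hasSum_exp' (𝕂 := ℂ) M).map (Matrix.mulVec.addMonoidHomLeft v) hc
  have h2 := (NormedSpace.exp_series_hasSum_exp' (𝕂 := ℂ) z).smul_const v
  rw [← Complex.exp_eq_exp_ℂ] at h2
  refine h1.unique ?_
  simpa only [Matrix.smul_mulVec, hp, smul_smul, smul_eq_mul] using h2

/-- M commutes with exp M, hence preserves its w-eigenspace and has an eigenvector there; its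
eigenvalue z satisfies e^z = w. -/
lemma exists_exp_eq_of_mem_spectrum_exp (M : Matrix (Fin p) (Fin p) ℂ) {w : ℂ}
    (hw : w ∈ spectrum ℂ (NormedSpace.exp M)) : ∃ z ∈ spectrum ℂ M, Complex.exp z = w := by
  have hcomm : Commute M (NormedSpace.exp M) := (Commute.refl M).exp_right
  set E := Module.End.eigenspace (Matrix.toLin' (NormedSpace.exp M)) w
  rw [← Matrix.spectrum_toLin', ← Module.End.hasEigenvalue_iff_mem_spectrum] at hw
  have hE : ∀ v ∈ E, Matrix.toLin' M v ∈ E := fun v hv => by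
    rw [Module.End.mem_eigenspace_iff] at hv ⊢
    simp only [Matrix.toLin'_apply] at hv ⊢
    rw [Matrix.mulVec_mulVec, ← hcomm.eq, ← Matrix.mulVec_mulVec, hv, Matrix.mulVec_smul]
  have : Nontrivial E := Submodule.nontrivial_iff_ne_bot.2 hw
  obtain ⟨z, hz⟩ := Module.End.exists_eigenvalue ((Matrix.toLin' M).restrict hE)
  obtain ⟨v, hv⟩ := hz.exists_hasEigenvector
  have hv1 : M *ᵥ (v : Fin p → ℂ) = z • (v : Fin p → ℂ) := by
    have := congrArg Subtype.val hv.apply_eq_smul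
    simpa using this
  have hv0 : (v : Fin p → ℂ) ≠ 0 := fun h => hv.2 (Subtype.ext h)
  refine ⟨z, ?_, ?_⟩
  · rw [← Matrix.spectrum_toLin', ← Module.End.hasEigenvalue_iff_mem_spectrum]
    exact Module.End.hasEigenvalue_of_hasEigenvector
      (Module.End.hasEigenvector_iff.2 ⟨Module.End.mem_eigenspace_iff.2 (by simpa using hv1), hv0⟩)
  · have h1 := Module.End.mem_eigenspace_iff.1 v.2
    rw [Matrix.toLin'_apply, exp_mulVec_of_eigenvector M hv1] at h1
    exact smul_left_injective ℂ hv0 h1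

/-- The semigroup `exp (s M)` grows at most like `e^{cs}` if `c` exceeds the spectral abscissa. -/
lemma exists_norm_exp_smul_le [NeZero p] (M : Matrix (Fin p) (Fin p) ℂ) {c : ℝ}
    (hM : ∀ z ∈ spectrum ℂ M, z.re < c) :
    ∃ C : ℝ, ∀ s : ℝ, 0 ≤ s → ‖NormedSpace.exp ((s : ℂ) • M)‖ ≤ C * Real.exp (c * s) := by
  let : NormedAlgebra ℚ (Matrix (Fin p) (Fin p) ℂ) := NormedAlgebra.restrictScalars ℚ ℂ _
  set B := NormedSpace.exp M
  have hr : spectralRadius ℂ B < (Real.exp c).toNNReal := by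
    refine spectrum.spectralRadius_lt_of_forall_lt B fun w hw => ?_
    obtain ⟨z, hz, rfl⟩ := exists_exp_eq_of_mem_spectrum_exp M hw
    rw [← NNReal.coe_lt_coe, coe_nnnorm, Complex.norm_exp,
      Real.coe_toNNReal _ (Real.exp_pos c).le]
    exact Real.exp_lt_exp.2 (hM z hz)
  -- Gelfand's formula, using that the spectral radius of exp M is below e^c.
  have hev : ∀ᶠ n : ℕ in atTop, ‖B ^ n‖ ≤ Real.exp (c * n) := by
    have ht := spectrum.pow_nnnorm_pow_one_div_tendsto_nhds_spectralRadius B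
    filter_upwards [ht.eventually_lt_const hr, eventually_gt_atTop 0] with n hn hn0
    have h1 := ENNReal.rpow_le_rpow hn.le (z := n) (by positivity)
    rw [← ENNReal.rpow_mul, one_div_mul_cancel (by positivity), ENNReal.rpow_one,
      ENNReal.rpow_natCast, ← ENNReal.coe_pow, ENNReal.coe_le_coe, ← NNReal.coe_le_coe,
      coe_nnnorm, NNReal.coe_pow, Real.coe_toNNReal _ (Real.exp_pos c).le] at h1
    rwa [mul_comm, Real.exp_nat_mul]
  obtain ⟨n₀, hn₀⟩ := eventually_atTop.1 hev
  obtain ⟨C₁, hC₁⟩ : ∃ C₁ : ℝ, ∀ n : ℕ, ‖B ^ n‖ ≤ C₁ * Real.exp (c * n) := by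
    -- The finitely many powers not covered by Gelfand's formula are absorbed into the constant.
    refine ⟨1 + ∑ k ∈ Finset.range n₀, ‖B ^ k‖ / Real.exp (c * k), fun n => ?_⟩
    have hs : ∀ k ∈ Finset.range n₀, 0 ≤ ‖B ^ k‖ / Real.exp (c * k) := fun k _ => by positivity
    rcases le_or_gt n₀ n with h | h
    · refine (hn₀ n h).trans (le_mul_of_one_le_left (Real.exp_pos _).le ?_)
      linarith [Finset.sum_nonneg hs]
    · rw [← div_le_iff₀ (Real.exp_pos _)]
      have := Finset.single_le_sum hs (Finset.mem_range.2 h)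
      linarith
  have hcont : Continuous fun r : ℝ => NormedSpace.exp ((r : ℂ) • M) :=
    NormedSpace.exp_continuous.comp (by fun_prop)
  obtain ⟨C₂, hC₂⟩ := (isCompact_Icc (a := (0 : ℝ)) (b := 1)).exists_bound_of_continuousOn
    hcont.continuousOn
  have hC₁0 : 0 ≤ C₁ := by
    have := (norm_nonneg _).trans (hC₁ 0)
    simpa using this
  -- s is split into integer and fractional parts: C₁ controls the powers, C₂ the compact interval
  -- [0, 1], and e^|c| the passage from cn to cs, where c may be negative.
  refine ⟨C₁ * C₂ * Real.exp |c|, fun s hs => ?_⟩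
  set n := ⌊s⌋₊
  have hn : (n : ℝ) ≤ s := Nat.floor_le hs
  have hn1 : s < n + 1 := Nat.lt_floor_add_one s
  have hsplit : NormedSpace.exp ((s : ℂ) • M) =
      B ^ n * NormedSpace.exp (((s - n : ℝ) : ℂ) • M) := by
    rw [show B = NormedSpace.exp M from rfl, ← Matrix.exp_nsmul, ← Matrix.exp_add_of_commute]
    · rw [← Nat.cast_smul_eq_nsmul ℂ, ← add_smul]
      push_cast
      ring_nf
    · exact ((Commute.refl M).smul_right _).smul_left _
  have h2 := hC₂ (s - n) ⟨by linarith, by linarith⟩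
  have hc : c * n ≤ |c| + c * s := by
    have : |c * (n - s)| ≤ |c| * 1 := by
      rw [abs_mul]
      refine mul_le_mul_of_nonneg_left ?_ (abs_nonneg c)
      rw [abs_le]
      constructor <;> linarith
    linarith [le_abs_self (c * (n - s))]
  calc ‖NormedSpace.exp ((s : ℂ) • M)‖ ≤ ‖B ^ n‖ * ‖NormedSpace.exp (((s - n : ℝ) : ℂ) • M)‖ := by
        rw [hsplit]; exact norm_mul_le _ _
    _ ≤ (C₁ * Real.exp (c * n)) * C₂ := by
        exact mul_le_mul (hC₁ n) h2 (norm_nonneg _) (by positivity)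
    _ ≤ (C₁ * (Real.exp |c| * Real.exp (c * s))) * C₂ := by
        have hC₂0 : 0 ≤ C₂ := (norm_nonneg _).trans h2
        rw [← Real.exp_add]
        gcongr
    _ = _ := by ring

lemma norm_apply_le_linftyOpNorm (M : Matrix (Fin p) (Fin p) ℂ) (i j : Fin p) : ‖M i j‖ ≤ ‖M‖ := by
  rw [Matrix.linfty_opNorm_def]
  have h1 : ‖M i j‖₊ ≤ ∑ j, ‖M i j‖₊ :=
    Finset.single_le_sum (f := fun j => ‖M i j‖₊) (fun _ _ => zero_le) (Finset.mem_univ j)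
  exact_mod_cast h1.trans (Finset.le_sup (f := fun i => ∑ j, ‖M i j‖₊) (Finset.mem_univ i))

lemma map_ofReal_exp_smul (M : Matrix (Fin p) (Fin p) ℝ) (s : ℝ) :
    (NormedSpace.exp (s • M)).map Complex.ofReal =
      NormedSpace.exp ((s : ℂ) • M.map Complex.ofReal) := by
  let : NormedAlgebra ℚ (Matrix (Fin p) (Fin p) ℝ) := NormedAlgebra.restrictScalars ℚ ℝ _
  have h := NormedSpace.map_exp (Complex.ofRealHom.mapMatrix (m := Fin p))
    (by exact continuous_id.matrix_map Complex.continuous_ofReal) (s • M)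
  refine (show _ = _ from h).trans (congrArg _ ?_)
  ext i j
  simp

/-- Entrywise bound for `exp (s M)`, `s ≥ 0`, by the spectral abscissa of a real matrix `M`. -/
lemma exists_abs_exp_smul_apply_le (M : Matrix (Fin p) (Fin p) ℝ) {c : ℝ}
    (hM : ∀ z ∈ spectrum ℂ (M.map Complex.ofReal), z.re < c) :
    ∃ C : ℝ, ∀ s : ℝ, 0 ≤ s → ∀ i j, |NormedSpace.exp (s • M) i j| ≤ C * Real.exp (c * s) := by
  rcases Nat.eq_zero_or_pos p with rfl | hp
  · exact ⟨0, fun s _ i => i.elim0⟩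
  · have : NeZero p := ⟨hp.ne'⟩
    obtain ⟨C, hC⟩ := exists_norm_exp_smul_le (M.map Complex.ofReal) hM
    refine ⟨C, fun s hs i j => ?_⟩
    refine le_trans (le_of_eq ?_)
      ((norm_apply_le_linftyOpNorm (NormedSpace.exp ((s : ℂ) • M.map Complex.ofReal)) i j).trans
        (hC s hs))
    rw [← map_ofReal_exp_smul, Matrix.map_apply, Complex.norm_real, Real.norm_eq_abs]

lemma continuous_exp_smul_apply (M : Matrix (Fin p) (Fin p) ℝ) (i j : Fin p) :
    Continuous fun s : ℝ => NormedSpace.exp (s • M) i j := by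
  let : NormedAlgebra ℚ (Matrix (Fin p) (Fin p) ℝ) := NormedAlgebra.restrictScalars ℚ ℝ _
  have : Continuous fun s : ℝ => NormedSpace.exp (s • M) :=
    NormedSpace.exp_continuous.comp (by fun_prop)
  exact this.matrix_elem i j

end MatrixExponential

/-! ### Square integrability of the harmonizable kernel -/

section SquareIntegrability

variable {p : ℕ} {H : Matrix (Fin p) (Fin p) ℝ}

lemma exists_abs_re_sub_half_lt (hH : reEig H ⊆ Set.Ioo 0 1) :
    ∃ b : ℝ, 0 < b ∧ b < 1 / 2 ∧ ∀ z ∈ spectrum ℂ (H.map Complex.ofReal), |z.re - 1 / 2| < b := by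
  have hfin : (spectrum ℂ (H.map Complex.ofReal)).Finite := by
    rw [← Matrix.spectrum_toLin']
    exact Module.End.finite_spectrum _
  rcases (spectrum ℂ (H.map Complex.ofReal)).eq_empty_or_nonempty with he | hne
  · exact ⟨1 / 4, by norm_num, by norm_num, by simp [he]⟩
  · obtain ⟨z₀, hz₀, hmax⟩ := hfin.exists_maximalFor (fun z : ℂ => |z.re - 1 / 2|) _ hne
    have h0 := hH ⟨z₀, hz₀, rfl⟩
    have h1 : |z₀.re - 1 / 2| < 1 / 2 := by
      rw [abs_lt]; constructor <;> linarith [h0.1, h0.2]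
    -- The midpoint between the largest deviation, attained as the spectrum is finite, and 1/2.
    refine ⟨(|z₀.re - 1 / 2| + 1 / 2) / 2, by positivity, by linarith, fun z hz => ?_⟩
    have : |z.re - 1 / 2| ≤ |z₀.re - 1 / 2| := by
      by_contra hlt
      exact hlt (hmax hz (not_le.1 hlt).le)
    linarith

lemma map_sub_half (H : Matrix (Fin p) (Fin p) ℝ) :
    (H - (1 / 2 : ℝ) • (1 : Matrix (Fin p) (Fin p) ℝ)).map Complex.ofReal =
      H.map Complex.ofReal - algebraMap ℂ (Matrix (Fin p) (Fin p) ℂ) (1 / 2) := by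
  ext i j
  by_cases hij : i = j <;> simp [hij, Matrix.algebraMap_matrix_apply]

/-- For x ≥ 1, x^(-D) is exp(s(-D)) with s = log x ≥ 0; for x ≤ 1 it is exp(sD) with s = -log x ≥ 0.
All eigenvalues of D have real part of modulus below b, so the growth bound applies to both. -/
lemma exists_abs_posPow_le (hH : reEig H ⊆ Set.Ioo 0 1) :
    ∃ b C : ℝ, 0 < b ∧ b < 1 / 2 ∧ 0 ≤ C ∧ ∀ i j,
      (∀ x : ℝ, 1 ≤ x → |posPow x (-(H - (1 / 2 : ℝ) • 1)) i j| ≤ C * x ^ b) ∧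
      (∀ x : ℝ, 0 < x → x ≤ 1 → |posPow x (-(H - (1 / 2 : ℝ) • 1)) i j| ≤ C * x ^ (-b)) := by
  obtain ⟨b, hb0, hb, hz⟩ := exists_abs_re_sub_half_lt hH
  set D := H - (1 / 2 : ℝ) • (1 : Matrix (Fin p) (Fin p) ℝ) with hD
  have hspec : ∀ w ∈ spectrum ℂ (D.map Complex.ofReal), |w.re| < b := fun w hw => by
    rw [hD, map_sub_half, ← spectrum.sub_singleton_eq] at hw
    obtain ⟨z, hz', y, hy, rfl⟩ := hw
    rw [Set.mem_singleton_iff.1 hy]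
    have := hz z hz'
    norm_num at this ⊢
    exact this
  obtain ⟨C₁, hC₁⟩ := exists_abs_exp_smul_apply_le D (c := b) fun w hw =>
    (le_abs_self _).trans_lt (hspec w hw)
  obtain ⟨C₂, hC₂⟩ := exists_abs_exp_smul_apply_le (-D) (c := b) fun w hw => by
    have hw' : -w ∈ spectrum ℂ (D.map Complex.ofReal) := by
      have hneg : (-D).map Complex.ofReal = -D.map Complex.ofReal := by ext i j; simp
      rwa [hneg, ← spectrum.neg_eq] at hw
    have := (neg_le_abs _).trans_lt (hspec _ hw')
    simpa using this
  refine ⟨b, max 0 (max C₁ C₂), hb0, hb, le_max_left _ _, fun i j => ⟨fun x hx => ?_,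
    fun x hx0 hx => ?_⟩⟩
  · have hx0 : 0 < x := by linarith
    rw [posPow, if_pos hx0]
    refine (hC₂ _ (Real.log_nonneg hx) i j).trans ?_
    rw [Real.rpow_def_of_pos hx0, mul_comm b]
    gcongr
    exact (le_max_right _ _).trans (le_max_right _ _)
  · rw [posPow, if_pos hx0]
    have h := hC₁ (-Real.log x) (by linarith [Real.log_nonpos hx0.le hx]) i j
    rw [show -Real.log x • D = Real.log x • -D by simp] at h
    refine h.trans ?_
    rw [Real.rpow_def_of_pos hx0, show b * -Real.log x = Real.log x * -b by ring]
    gcongr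
    exact (le_max_left _ _).trans (le_max_right _ _)

lemma measurable_posPow_apply (M : Matrix (Fin p) (Fin p) ℝ) (i j : Fin p) :
    Measurable fun x : ℝ => posPow x M i j := by
  have : (fun x : ℝ => posPow x M i j) =
      fun x => if 0 < x then NormedSpace.exp (Real.log x • M) i j else 0 := by
    funext x
    simp only [posPow]
    split_ifs <;> rfl
  rw [this]
  exact Measurable.ite measurableSet_Ioi
    ((continuous_exp_smul_apply M i j).measurable.comp Real.measurable_log) measurable_const

lemma measurable_harmKernel_apply (H : Matrix (Fin p) (Fin p) ℝ) (A : Matrix (Fin p) (Fin p) ℂ)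
    (t : ℝ) (i j : Fin p) : Measurable fun x => harmKernel H A t x i j := by
  simp only [harmKernel, Matrix.smul_apply, Matrix.add_apply, Matrix.mul_apply, Matrix.map_apply,
    smul_eq_mul]
  have h := measurable_posPow_apply (-(H - (1 / 2 : ℝ) • 1))
  refine Measurable.mul (by fun_prop) (Measurable.add ?_ ?_)
  · exact Finset.measurable_sum _ fun k _ =>
      (Complex.measurable_ofReal.comp (h i k)).mul_const _
  · exact Finset.measurable_sum _ fun k _ =>
      (Complex.measurable_ofReal.comp ((h i k).comp measurable_neg)).mul_const _

lemma norm_harmKernel_apply_le (A : Matrix (Fin p) (Fin p) ℂ) (t : ℝ) {x B : ℝ} (hx : 0 < x)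
    (i j : Fin p) (hB : ∀ k, |posPow x (-(H - (1 / 2 : ℝ) • 1)) i k| ≤ B) :
    ‖harmKernel H A t x i j‖ ≤
      ‖Complex.exp (Complex.I * t * x) - 1‖ / x * (B * ∑ k, ‖A k j‖) := by
  have hneg : posPow (-x) (-(H - (1 / 2 : ℝ) • 1)) = 0 := if_neg (by linarith)
  rw [harmKernel, hneg]
  simp only [Matrix.smul_apply, Matrix.add_apply, Matrix.mul_apply, Matrix.map_apply, smul_eq_mul,
    Matrix.zero_apply, Complex.ofReal_zero, zero_mul, Finset.sum_const_zero, add_zero]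
  rw [norm_mul, norm_div, norm_mul, Complex.norm_I, one_mul, Complex.norm_real, Real.norm_eq_abs,
    abs_of_pos hx]
  refine mul_le_mul_of_nonneg_left ?_ (by positivity)
  rw [Finset.mul_sum]
  refine (norm_sum_le _ _).trans (Finset.sum_le_sum fun k _ => ?_)
  rw [norm_mul, Complex.norm_real, Real.norm_eq_abs]
  exact mul_le_mul_of_nonneg_right (hB k) (norm_nonneg _)

/-- The harmonizable kernel is square integrable. -/
lemma memLp_harmKernel (hH : reEig H ⊆ Set.Ioo 0 1) (A : Matrix (Fin p) (Fin p) ℂ) (t : ℝ)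
    (i j : Fin p) : MemLp (fun x => harmKernel H A t x i j) 2 (volume : Measure ℝ) := by
  obtain ⟨b, C, hb0, hb, hC, hbd⟩ := exists_abs_posPow_le hH
  have hm := measurable_harmKernel_apply H A t i j
  set f : ℝ → ℝ := fun x => ‖harmKernel H A t x i j‖ ^ 2 with hf
  have hfm : Measurable f := hm.norm.pow_const 2
  rw [memLp_two_iff_integrable_sq_norm hm.aestronglyMeasurable]
  have heven : ∀ x, f (-x) = f x := fun x => by
    simp only [hf, harmKernel_neg, RCLike.norm_conj]
  set S := ∑ k, ‖A k j‖
  have hS : 0 ≤ S := Finset.sum_nonneg fun _ _ => norm_nonneg _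
  have hI : ∀ x : ℝ, Complex.I * t * x = Complex.I * ((t * x : ℝ) : ℂ) := fun x => by
    push_cast; ring
  -- Near 0, |e^{itx} - 1| ≤ |t| x leaves a kernel of size x^(-b), and 2b < 1.
  have hsmall : IntegrableOn f (Set.Ioc 0 1) volume := by
    have hg : IntegrableOn (fun x : ℝ => (|t| * (C * S)) ^ 2 * x ^ (-(2 * b))) (Set.Ioc 0 1) := by
      have := intervalIntegral.intervalIntegrable_rpow' (a := 0) (b := 1) (r := -(2 * b))
        (by linarith)
      rw [intervalIntegrable_iff_integrableOn_Ioc_of_le zero_le_one] at this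
      exact this.const_mul _
    refine hg.mono' hfm.aestronglyMeasurable ?_
    filter_upwards [ae_restrict_mem measurableSet_Ioc] with x hx
    have h1 := norm_harmKernel_apply_le A t hx.1 i j fun k => (hbd i k).2 x hx.1 hx.2
    have h2 : ‖Complex.exp (Complex.I * t * x) - 1‖ / x ≤ |t| := by
      rw [div_le_iff₀ hx.1, hI]
      refine Real.norm_exp_I_mul_ofReal_sub_one_le.trans ?_
      rw [Real.norm_eq_abs, abs_mul, abs_of_pos hx.1]
    have h3 : ‖harmKernel H A t x i j‖ ≤ |t| * (C * S) * x ^ (-b) := by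
      refine h1.trans ((mul_le_mul_of_nonneg_right h2 ?_).trans (le_of_eq (by ring)))
      have := Real.rpow_nonneg hx.1.le (-b)
      positivity
    rw [Real.norm_of_nonneg (by positivity)]
    refine (pow_le_pow_left₀ (norm_nonneg _) h3 2).trans (le_of_eq ?_)
    rw [mul_pow, ← Real.rpow_natCast (x ^ (-b)), ← Real.rpow_mul hx.1.le]
    congr 2
    push_cast; ring
  -- At infinity, |e^{itx} - 1| ≤ 2 leaves a kernel of size x^(b-1), and 2b - 2 < -1.
  have hlarge : IntegrableOn f (Set.Ioi 1) volume := by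
    have hg : IntegrableOn (fun x : ℝ => (2 * (C * S)) ^ 2 * x ^ (2 * b - 2)) (Set.Ioi 1) :=
      (integrableOn_Ioi_rpow_of_lt (by linarith) one_pos).const_mul _
    refine hg.mono' hfm.aestronglyMeasurable ?_
    filter_upwards [ae_restrict_mem measurableSet_Ioi] with x hx
    have hx1 : 1 < x := hx
    have hx0 : 0 < x := by linarith
    have h1 := norm_harmKernel_apply_le A t hx0 i j fun k => (hbd i k).1 x hx1.le
    have h2 : ‖Complex.exp (Complex.I * t * x) - 1‖ / x ≤ 2 * x⁻¹ := by
      rw [div_eq_mul_inv]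
      refine mul_le_mul_of_nonneg_right ((norm_sub_le _ _).trans ?_) (by positivity)
      rw [hI, Complex.norm_exp_I_mul_ofReal, norm_one]
      norm_num
    have h3 : ‖harmKernel H A t x i j‖ ≤ 2 * (C * S) * x ^ (b - 1) := by
      refine h1.trans ((mul_le_mul_of_nonneg_right h2 ?_).trans (le_of_eq ?_))
      · have := Real.rpow_nonneg hx0.le b
        positivity
      · rw [Real.rpow_sub_one hx0.ne']
        ring
    rw [Real.norm_of_nonneg (by positivity)]
    refine (pow_le_pow_left₀ (norm_nonneg _) h3 2).trans (le_of_eq ?_)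
    rw [mul_pow, ← Real.rpow_natCast (x ^ (b - 1)), ← Real.rpow_mul hx0.le]
    congr 2
    push_cast; ring
  have hpos : IntegrableOn f (Set.Ioi 0) volume := by
    rw [← Set.Ioc_union_Ioi_eq_Ioi zero_le_one]
    exact hsmall.union hlarge
  have hneg : IntegrableOn f (Set.Iio 0) volume := by
    have := (Measure.measurePreserving_neg (volume : Measure ℝ)).integrableOn_comp_preimage
      (Homeomorph.neg ℝ).measurableEmbedding (f := f) (s := Set.Ioi 0)
    have h2 := this.2 hpos
    have hset : (Neg.neg : ℝ → ℝ) ⁻¹' Set.Ioi 0 = Set.Iio 0 := by ext; simp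
    rw [hset] at h2
    exact h2.congr_fun (fun x _ => heven x) measurableSet_Iio
  rw [← integrableOn_univ, ← Set.Iio_union_Ici (a := (0 : ℝ))]
  exact hneg.union ((integrableOn_Ici_iff_integrableOn_Ioi (by simp)).2 hpos)

end SquareIntegrability

lemma measurable_toC {p : ℕ} :
    Measurable (toC : EuclideanSpace ℝ (Fin p) → EuclideanSpace ℂ (Fin p)) := by
  unfold toC
  fun_prop

end OfLm

end

/-! ### The two representations -/

theorem propositionp {p : ℕ} (H : Matrix (Fin p) (Fin p) ℝ)
    (hH : OfLm.reEig H ⊆ Set.Ioo 0 1 \ {1 / 2}) (A : Matrix (Fin p) (Fin p) ℂ) :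
    (∀ {Ω Ω₀ : Type*} [MeasurableSpace Ω] [MeasurableSpace Ω₀]
        (P : Measure Ω) [IsProbabilityMeasure P] (P₀ : Measure Ω₀) [IsProbabilityMeasure P₀]
        (μ : Measure (EuclideanSpace ℝ (Fin p)))
        (N : Ω₀ → Measure (ℝ × EuclideanSpace ℝ (Fin p)))
        (X : ℝ → Ω → EuclideanSpace ℝ (Fin p)),
      OfLm.IsMaofLm H A μ N P₀ X P → OfLm.UnitSecondMoment μ →
      ∃ (Φ : Set ℝ → Ω₀ → EuclideanSpace ℂ (Fin p)) (Y : ℝ → Ω₀ → EuclideanSpace ℂ (Fin p)),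
        OfLm.IsOrthogonalRandomMeasure Φ P₀ ∧
        (∀ t, OfLm.IsOrthIntegral Φ P₀ (OfLm.harmKernel H A t) (Y t)) ∧
        OfLm.FddEq (fun t ω => OfLm.toC (X t ω)) P Y P₀) ∧
    (∀ {Ω : Type*} [MeasurableSpace Ω] (P : Measure Ω) [IsProbabilityMeasure P]
        (μ : Measure (EuclideanSpace ℂ (Fin p)))
        (N : Ω → Measure (ℝ × EuclideanSpace ℂ (Fin p)))
        (X : ℝ → Ω → EuclideanSpace ℝ (Fin p)),
      OfLm.IsRhofLm H A μ N X P → OfLm.UnitSecondMomentC μ → OfLm.RotationInvariant μ →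
      ∃ (Φ : Set ℝ → Ω → EuclideanSpace ℝ (Fin p)) (Y : ℝ → Ω → EuclideanSpace ℝ (Fin p)),
        OfLm.IsOrthogonalRandomMeasure Φ P ∧
        (∀ t, OfLm.IsOrthIntegral Φ P (OfLm.maKernel H A t) (Y t)) ∧
        OfLm.FddEq X P Y P) := by
  have hL := fun t => OfLm.memLp_harmKernel (hH.trans Set.sdiff_subset) A t
  constructor
  · intro Ω Ω₀ _ _ P _ P₀ _ μ N X hX hI
    have := hX.levy.sFinite
    obtain ⟨Y, hY, hXY⟩ := hX.repr
    refine ⟨OfLm.orthMeasure (OfLm.maOperator hX.poisson hX.levy), fun t ω => OfLm.toC (Y t ω),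
      OfLm.isOrthogonalRandomMeasure_orthMeasure
        (OfLm.inner_maOperator hX.poisson hX.levy hI)
        fun i f => hX.poisson.integral_integral_eq_zero _,
      fun t => OfLm.isOrthIntegral_orthMeasure (hL t)
        (OfLm.maOperator_harmKernel hX.poisson hX.levy (hL t) (hY t)), fun n t => ?_⟩
    exact (hXY n t).comp (u := fun x i => OfLm.toC (x i))
      (measurable_pi_lambda _ fun i => OfLm.measurable_toC.comp (measurable_pi_apply i))
  · intro Ω _ P _ μ N X hX hI hr
    have := hX.levy.sFinite
    have hint := fun t => OfLm.isOrthIntegral_orthMeasure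
      (fun i j => OfLm.memLp_maKernel (hL t i j))
      (OfLm.realHarmOperator_maKernel hX.poisson hX.levy (hL t) (hX.repr t))
    -- The process X is itself a version of the new integral, so equality of the finite-dimensional
    -- distributions is reflexivity.
    refine ⟨OfLm.orthMeasure (OfLm.realHarmOperator hX.poisson hX.levy), X,
      OfLm.isOrthogonalRandomMeasure_orthMeasure
        (OfLm.inner_realHarmOperator hX.poisson hX.levy hI hr)
        (OfLm.integral_realHarmOperator hX.poisson hX.levy),
      hint, fun n t => ?_⟩
    exact IdentDistrib.refl (aemeasurable_pi_lambda _ fun i => (hint (t i)).2.1.aemeasurable)
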